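/- \textbf{Setting.} Let $\mathcal X$ be a finite domain (for instance $\{0,1\}^n$), let $\mathcal C$ be a class of functions $\mathcal X\to\{0,1\}$ (the concept class), and let $\mathcal H$ be a class of functions $\mathcal X\to\{0,1\}$ (the hypothesis class) of VC-dimension $d$. For a distribution $D$ on $\mathcal X$ and $f,h:\mathcal X\to\{0,1\}$ put $\mathrm{err}_{D,f}(h)=\Pr_{x\sim D}[h(x)\neq f(x)]$. For $\gamma\in(0,1/2)$, a $\gamma$-weak learner for $\mathcal C$ with hypothesis class $\mathcal H$ is a (randomized or quantum) procedure which, for every $f\in\mathcal C$ and every distribution $D'$ on $\mathcal X$, when it is fed (classical or quantum) examples of $D'$ labelled by $f$, returns with certainty some $h\in\mathcal H$ with $\mathrm{err}_{D',f}(h)\le \frac12-\gamma$. \textbf{QuantumBoost.} The algorithm has parameters $\gamma\in(0,1/2)$, an accuracy $\varepsilon'\in(0,1)$ and a failure bound $\delta'\in(0,1)$, and uses a $\gamma$-weak learner and a training set $(x_i,y_i)_{i=1}^m$. Put $T=\lfloor 4\log(1/\varepsilon')/\gamma^2\rfloor+1$, $K=\lceil 1/\gamma\rceil$, $\zeta=\gamma/4$,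 and $M^1(i)=\varepsilon'$ for all $i\in[m]$. For $t=1,\dots,T$: feed the weak learner examples $(x_i,y_i)$ distributed according to $D^t=M^t/\sum_i M^t(i)$, and let $h_t$ be its output; put $N^{t+1}(i)=M^t(i)(1-\gamma)^{[h_t(x_i)=y_i]}$; if $K$ does not divide $t$, put $M^{t+1}=N^{t+1}$; if $K$ divides $t$, put $M^{t+1}=\min(1,\tilde c_t N^{t+1})$, where $\tilde c_t$ is found by binary search in $[1,(1-\gamma)^{-K}]$, aiming at $$\varepsilon'\le \frac1m\sum_{i=1}^m\min(1,\tilde c_t N^{t+1}(i))\le(1+\zeta)\varepsilon'.$$ The binary search has $B=\lceil\log_2(8((1-\gamma)^{-K}-1)/\zeta)\rceil$ steps; each step estimates the mean $\frac1m\sum_i\min(1,cN^{t+1}(i))$ at the midpoint $c$ of the current interval, and continues in the lower half if the estimate is at least $(1+\zeta/2)\varepsilon'$ and in the upper half otherwise; $\tilde c_t$ is the upper end of the last interval. A mean of $v\in[0,1]^m$ is estimated by quantum amplitude estimation: phase estimation, with a control register of dimension $P=64(\lceil 8/(\zeta\sqrt{\varepsilon'})\rceil+1)$, of the operator $(2|\psi\rangle\langle\psi|-I)(I\otimes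 Z)$ on the initial state $|\psi\rangle=\frac1{\sqrt m}\sum_i|i\rangle(\sqrt{v_i}|1\rangle+\sqrt{1-v_i}|0\rangle)$ (where $Z|b\rangle=(-1)^b|b\rangle$), with outcome $y$ turned into the estimate $\sin^2(\pi y/P)$; the median over $2\lceil\log(TB/\delta')\rceil+1$ independent runs is used. The output is the majority vote $H=\mathrm{MAJ}(h_1,\dots,h_T)$ (a tie counts as $0$). \textbf{Corollary (generalization error of QuantumBoost).} For every $\gamma\in(0,1/2)$ there is a constant $c>0$, depending only on $\gamma$, such that the following holds for all $\mathcal X$, $\mathcal C$, $\mathcal H$ as above, every $\gamma$-weak learner for $\mathcal C$ with hypothesis class $\mathcal H$, all $\varepsilon,\delta\in(0,1)$, and all integers $m\ge1$ with $$m\;\ge\; c\cdot\frac{d\log\frac{d}{\delta\varepsilon}+\log\frac1\delta}{\varepsilon^2}$$ (where $d\log\frac d{\delta\varepsilon}$ is read as $0$ if $d=0$): for every $f\in\mathcal C$ and every distribution $D$ on $\mathcal X$, if QuantumBoost is run with $\varepsilon'=\varepsilon/2$ and $\delta'=\delta/2$ on the training set $(x_i,f(x_i))_{i=1}^m$ with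 $x_1,\dots,x_m$ drawn independently from $D$, then its output $H$ satisfies $$\Pr_{x\sim D}[H(x)\neq f(x)]\le\varepsilon$$ with probability at least $1-\delta$ over the choice of the training set and the internal randomness of the algorithm and of the weak learner. -/

import Mathlib

noncomputable section

namespace QBoost

/-! ## Learning: errors, samples, VC dimension -/

/-- The generalization error `Pr_{x ∼ D}[h x ≠ f x]`. -/
def err {X : Type*} (D : PMF X) (f h : X → Bool) : ℝ :=
  (D.toOuterMeasure {x | h x ≠ f x}).toReal

/-- The VC-dimension of a finite class of Boolean functions, i.e. the size of a largest set on
which every labelling is realized by a member of the class. -/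
def vcDim {X : Type*} [Fintype X] [DecidableEq X] (H : Finset (X → Bool)) : ℕ :=
  (H.image fun h => Finset.univ.filter fun x => h x = true).vcDim

/-- The law of `k` independent draws from `p`. -/
def iid {α : Type*} [Fintype α] (p : PMF α) (k : ℕ) : PMF (Fin k → α) :=
  PMF.ofFintype (fun v => ∏ i, p (v i)) (by
    classical
    have h := Finset.prod_univ_sum (fun _ : Fin k => (Finset.univ : Finset α)) (fun _ a => p a)
    rw [Fintype.piFinset_univ] at h
    rw [← h]
    have hp : ∑ a, p a = 1 := by rw [← tsum_fintype (L := .unconditional _)]; exact p.tsum_coe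
    simp [hp])

/-- Labelling a point by the target function. -/
def labelled {X : Type*} (f : X → Bool) (x : X) : X × Bool := (x, f x)

/-! ## Weak learners -/

/-- A (classical or quantum) learner, given by the law of the hypothesis that it returns when it is
fed examples of a distribution `P` on labelled points. For a quantum learner, which applies a POVM
`(E_h)` to `W` copies of the quantum example `|P⟩ = ∑ √(P (x,y)) |x,y⟩`, this is the law
`h ↦ ⟨P|^{⊗ W} E_h |P⟩^{⊗ W}`; no restriction to a particular way of accessing `P` is made. -/
abbrev Learner (X : Type*) := PMF (X × Bool) → PMF (X → Bool)

/-- `L` is a `γ`-weak learner for the concept class `C` with hypothesis class `H`: for every target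
in `C` and every distribution, it returns with certainty an element of `H` of error at most
`1/2 - γ`. -/
def IsWeakLearner {X : Type*} (γ : ℝ) (C : Set (X → Bool)) (H : Finset (X → Bool))
    (L : Learner X) : Prop :=
  ∀ f ∈ C, ∀ D : PMF X, ∀ h ∈ (L (D.map (labelled f))).support, h ∈ H ∧ err D f h ≤ 1 / 2 - γ

/-! ## Quantum phase estimation and mean estimation -/

theorem sum_exp_orthogonal (P : ℕ) [NeZero P] (j k : Fin P) :
    ∑ y : Fin P, (starRingEnd ℂ) (Complex.exp (-(2 * Real.pi * Complex.I * (j : ℕ) * (y : ℕ) / P)))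
      * Complex.exp (-(2 * Real.pi * Complex.I * (k : ℕ) * (y : ℕ) / P))
      = if j = k then (P : ℂ) else 0 := by
  have hP : (P : ℂ) ≠ 0 := Nat.cast_ne_zero.2 (NeZero.ne P)
  have hterm : ∀ y : Fin P,
      (starRingEnd ℂ) (Complex.exp (-(2 * Real.pi * Complex.I * (j : ℕ) * (y : ℕ) / P)))
      * Complex.exp (-(2 * Real.pi * Complex.I * (k : ℕ) * (y : ℕ) / P))
      = (Complex.exp (2 * Real.pi * Complex.I * (((j : ℕ) : ℂ) - ((k : ℕ) : ℂ)) / P)) ^ (y : ℕ) := by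
    intro y
    rw [← Complex.exp_conj, ← Complex.exp_add, ← Complex.exp_nat_mul]
    congr 1
    simp only [map_neg, map_div₀, map_mul, Complex.conj_I, Complex.conj_ofReal, map_natCast,
      map_ofNat]
    ring
  simp only [hterm]
  rw [Fin.sum_univ_eq_sum_range
    (fun y => (Complex.exp (2 * Real.pi * Complex.I * (((j : ℕ) : ℂ) - ((k : ℕ) : ℂ)) / P)) ^ y) P]
  by_cases hjk : j = k
  · simp [hjk]
  · rw [if_neg hjk]
    set z := Complex.exp (2 * Real.pi * Complex.I * (((j : ℕ) : ℂ) - ((k : ℕ) : ℂ)) / P) with hz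
    have hz1 : z ^ P = 1 := by
      rw [hz, ← Complex.exp_nat_mul, Complex.exp_eq_one_iff]
      refine ⟨(j : ℕ) - (k : ℕ), ?_⟩
      push_cast
      field_simp
    have hne : z ≠ 1 := by
      intro h
      rw [hz, Complex.exp_eq_one_iff] at h
      obtain ⟨n, hn⟩ := h
      have h2 : (2 * Real.pi * Complex.I : ℂ) ≠ 0 := Complex.two_pi_I_ne_zero
      have h3 : (((j : ℕ) : ℂ) - ((k : ℕ) : ℂ)) = n * P := by
        have h4 : (2 * Real.pi * Complex.I : ℂ) * (((j : ℕ) : ℂ) - ((k : ℕ) : ℂ))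
            = (2 * Real.pi * Complex.I : ℂ) * (n * P) := by
          rw [div_eq_iff hP] at hn
          rw [hn]; ring
        exact mul_left_cancel₀ h2 h4
      have h5 : (((j : ℕ) : ℤ) - ((k : ℕ) : ℤ)) = n * P := by exact_mod_cast h3
      have hj : ((j : ℕ) : ℤ) < P := by exact_mod_cast j.2
      have hk : ((k : ℕ) : ℤ) < P := by exact_mod_cast k.2
      have hn0 : n = 0 := by
        by_contra hn0
        rcases lt_or_gt_of_ne hn0 with h | h <;> nlinarith
      apply hjk
      apply Fin.ext
      rw [hn0] at h5
      omega
    have := mul_geom_sum z P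
    rw [hz1, sub_self] at this
    exact (mul_eq_zero.1 this).resolve_left (sub_ne_zero.2 hne)

section PhaseEstimation

variable {V : Type*} [NormedAddCommGroup V] [InnerProductSpace ℂ V]

/-- The unnormalized state that goes with the value `y` of the control register after phase
estimation of the unitary `Q` on the initial state `ψ` with a control register of dimension `P`:
starting from `(1/√P) ∑_j |j⟩ ⊗ ψ`, apply `Q ^ j` controlled by `j`, and then the inverse quantum
Fourier transform `|j⟩ ↦ (1/√P) ∑_y exp (-2 π i j y / P) |y⟩`. -/
def phaseBranch (Q : V ≃ₗᵢ[ℂ] V) (ψ : V) (P : ℕ) (y : Fin P) : V :=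
  (P : ℂ)⁻¹ • ∑ j : Fin P,
    Complex.exp (-(2 * Real.pi * Complex.I * (j : ℕ) * (y : ℕ) / P)) • (Q ^ (j : ℕ)) ψ

theorem sum_norm_sq_phaseBranch (Q : V ≃ₗᵢ[ℂ] V) (ψ : V) (hψ : ‖ψ‖ = 1) (P : ℕ) [NeZero P] :
    ∑ y : Fin P, ‖phaseBranch Q ψ P y‖ ^ 2 = 1 := by
  have hP : (P : ℂ) ≠ 0 := Nat.cast_ne_zero.2 (NeZero.ne P)
  have hj : ∀ j : Fin P, inner ℂ ((Q ^ (j : ℕ)) ψ) ((Q ^ (j : ℕ)) ψ) = (1 : ℂ) := by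
    intro j
    rw [LinearIsometryEquiv.inner_map_map, inner_self_eq_norm_sq_to_K, hψ]
    simp
  have hy : ∀ y : Fin P, inner ℂ (phaseBranch Q ψ P y) (phaseBranch Q ψ P y)
      = (P : ℂ)⁻¹ * (P : ℂ)⁻¹ * ∑ j : Fin P, ∑ k : Fin P,
        ((starRingEnd ℂ) (Complex.exp (-(2 * Real.pi * Complex.I * (j : ℕ) * (y : ℕ) / P))) *
          Complex.exp (-(2 * Real.pi * Complex.I * (k : ℕ) * (y : ℕ) / P))) *
            inner ℂ ((Q ^ (j : ℕ)) ψ) ((Q ^ (k : ℕ)) ψ) := by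
    intro y
    rw [phaseBranch, inner_smul_left, inner_smul_right, map_inv₀, Complex.conj_natCast, ← mul_assoc,
      sum_inner]
    congr 1
    refine Finset.sum_congr rfl fun j _ => ?_
    rw [inner_sum]
    refine Finset.sum_congr rfl fun k _ => ?_
    rw [inner_smul_left, inner_smul_right]
    exact (mul_assoc _ _ _).symm
  have key : ∑ y : Fin P, inner ℂ (phaseBranch Q ψ P y) (phaseBranch Q ψ P y) = (1 : ℂ) := by
    rw [Finset.sum_congr rfl fun y _ => hy y, ← Finset.mul_sum, Finset.sum_comm]
    have h1 : ∀ j : Fin P, ∑ y : Fin P, ∑ k : Fin P,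
        ((starRingEnd ℂ) (Complex.exp (-(2 * Real.pi * Complex.I * (j : ℕ) * (y : ℕ) / P))) *
          Complex.exp (-(2 * Real.pi * Complex.I * (k : ℕ) * (y : ℕ) / P))) *
            inner ℂ ((Q ^ (j : ℕ)) ψ) ((Q ^ (k : ℕ)) ψ) = (P : ℂ) := by
      intro j
      rw [Finset.sum_comm]
      have h2 : ∀ k : Fin P, ∑ y : Fin P,
          ((starRingEnd ℂ) (Complex.exp (-(2 * Real.pi * Complex.I * (j : ℕ) * (y : ℕ) / P))) *
          Complex.exp (-(2 * Real.pi * Complex.I * (k : ℕ) * (y : ℕ) / P))) *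
            inner ℂ ((Q ^ (j : ℕ)) ψ) ((Q ^ (k : ℕ)) ψ)
          = (if j = k then (P : ℂ) else 0) * inner ℂ ((Q ^ (j : ℕ)) ψ) ((Q ^ (k : ℕ)) ψ) := by
        intro k
        rw [← Finset.sum_mul, sum_exp_orthogonal]
      rw [Finset.sum_congr rfl fun k _ => h2 k, Finset.sum_eq_single j]
      · rw [if_pos rfl, hj, mul_one]
      · intro k _ hk
        rw [if_neg (Ne.symm hk), zero_mul]
      · intro h
        exact absurd (Finset.mem_univ j) h
    rw [Finset.sum_congr rfl fun j _ => h1 j]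
    simp only [Finset.sum_const, Finset.card_univ, Fintype.card_fin, nsmul_eq_mul]
    rw [mul_mul_mul_comm, inv_mul_cancel₀ hP, one_mul]
  have h3 : ((∑ y : Fin P, ‖phaseBranch Q ψ P y‖ ^ 2 : ℝ) : ℂ) = 1 := by
    have h4 : ∀ x : V, inner ℂ x x = ((‖x‖ ^ 2 : ℝ) : ℂ) := by
      intro x
      rw [inner_self_eq_norm_sq_to_K, Complex.ofReal_pow]
      rfl
    rw [← key, Complex.ofReal_sum, Finset.sum_congr rfl fun y _ => h4 (phaseBranch Q ψ P y)]
  exact_mod_cast h3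

/-- The law of the measured control register in phase estimation. -/
def phaseEstimation (Q : V ≃ₗᵢ[ℂ] V) (ψ : V) (hψ : ‖ψ‖ = 1) (P : ℕ) [NeZero P] : PMF (Fin P) :=
  PMF.ofFintype (fun y => ENNReal.ofReal (‖phaseBranch Q ψ P y‖ ^ 2)) (by
    rw [← ENNReal.ofReal_sum_of_nonneg (fun _ _ => by positivity),
      sum_norm_sq_phaseBranch Q ψ hψ P, ENNReal.ofReal_one])

end PhaseEstimation

/-- The sign flip `|i⟩|b⟩ ↦ (-1)^b |i⟩|b⟩`. -/
def signFlip (m : ℕ) : EuclideanSpace ℂ (Fin m × Bool) ≃ₗᵢ[ℂ] EuclideanSpace ℂ (Fin m × Bool) :=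
  LinearIsometryEquiv.piLpCongrRight 2 fun s : Fin m × Bool =>
    if s.2 then LinearIsometryEquiv.neg ℂ else LinearIsometryEquiv.refl ℂ ℂ

/-- The state `(1/√m) ∑_i |i⟩ (√v_i |1⟩ + √(1 - v_i) |0⟩)`; the probability of measuring `1` in the
last qubit is the mean of `v`. -/
def meanState {m : ℕ} (v : Fin m → ℝ) : EuclideanSpace ℂ (Fin m × Bool) :=
  WithLp.toLp 2 fun s => ((Real.sqrt ((if s.2 then v s.1 else 1 - v s.1) / m) : ℝ) : ℂ)

theorem norm_meanState {m : ℕ} [NeZero m] (v : Fin m → ℝ) (h0 : ∀ i, 0 ≤ v i)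
    (h1 : ∀ i, v i ≤ 1) : ‖meanState v‖ = 1 := by
  have hm : (m : ℝ) ≠ 0 := Nat.cast_ne_zero.2 (NeZero.ne m)
  have hs : ∀ s : Fin m × Bool, ‖(meanState v) s‖ ^ 2
      = (if s.2 then v s.1 else 1 - v s.1) / m := by
    intro s
    have : 0 ≤ (if s.2 then v s.1 else 1 - v s.1) / (m : ℝ) := by
      refine div_nonneg ?_ (Nat.cast_nonneg m)
      split_ifs
      · exact h0 _
      · linarith [h1 s.1]
    rw [meanState, Complex.norm_real, Real.norm_eq_abs, sq_abs, Real.sq_sqrt this]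
  rw [EuclideanSpace.norm_eq, Finset.sum_congr rfl fun s _ => hs s, Fintype.sum_prod_type]
  have : ∀ i : Fin m, ∑ b : Bool, (if b then v i else 1 - v i) / (m : ℝ) = 1 / m := by
    intro i
    rw [Fintype.sum_bool]
    simp only [if_true, Bool.false_eq_true, if_false]
    ring
  simp only [this]
  simp [hm]

/-- The amplitude amplification operator `(2|ψ⟩⟨ψ| - 1) S` with `S` the sign flip. -/
def groverOp {m : ℕ} (ψ : EuclideanSpace ℂ (Fin m × Bool)) :
    EuclideanSpace ℂ (Fin m × Bool) ≃ₗᵢ[ℂ] EuclideanSpace ℂ (Fin m × Bool) :=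
  (signFlip m).trans (Submodule.span ℂ {ψ}).reflection

/-- The middle element of an odd number of reals. -/
def median {r : ℕ} (a : Fin (2 * r + 1) → ℝ) : ℝ := a (Tuple.sort a ⟨r, by omega⟩)

/-- Mean estimation of `v ∈ [0,1]^m` by amplitude estimation: `2 r + 1` independent runs of phase
estimation of the amplitude amplification operator, each of which turns its outcome `y` into the
estimate `sin² (π y / P)`; the median of the estimates is returned. -/
def meanEstimation {m : ℕ} [NeZero m] (v : Fin m → ℝ) (h0 : ∀ i, 0 ≤ v i) (h1 : ∀ i, v i ≤ 1)
    (P r : ℕ) [NeZero P] : PMF ℝ :=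
  (iid (phaseEstimation (groverOp (meanState v)) (meanState v) (norm_meanState v h0 h1) P)
    (2 * r + 1)).map fun y => median fun k => Real.sin (Real.pi * (y k : ℕ) / P) ^ 2

/-! ## Measures on the training set -/

/-- A measure on the indices of the training set, all of whose values are positive. -/
abbrev PosMeasure (m : ℕ) := Fin m → Set.Ioi (0 : ℝ)

/-- The normalized distribution `M / |M|`. -/
def PosMeasure.dist {m : ℕ} [NeZero m] (M : PosMeasure m) : PMF (Fin m) :=
  PMF.normalize (fun i => ENNReal.ofReal (M i)) (by
    rw [Ne, ENNReal.tsum_eq_zero]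
    intro h
    exact absurd (ENNReal.ofReal_eq_zero.1 (h 0)) (not_le.2 (M 0).2)) (by
    rw [tsum_fintype]
    exact ENNReal.sum_ne_top.2 fun _ _ => ENNReal.ofReal_ne_top)

/-- The measure `min (1, c M)`. -/
def PosMeasure.scale {m : ℕ} (M : PosMeasure m) (c : Set.Ici (1 : ℝ)) : PosMeasure m :=
  fun i => ⟨min 1 ((c : ℝ) * M i), by
    have hc : (1 : ℝ) ≤ c := c.2
    have hM : (0 : ℝ) < M i := (M i).2
    exact lt_min one_pos (mul_pos (by linarith) hM)⟩

/-! ## QuantumBoost -/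

/-- The parameters of QuantumBoost: the advantage `γ` of the weak learner, the accuracy `ε`, and the
bound `δ` on the probability that one of the approximate projections fails. -/
structure Params where
  γ : ℝ
  ε : ℝ
  δ : ℝ
  hγ : γ ∈ Set.Ioo (0 : ℝ) (1 / 2)
  hε : ε ∈ Set.Ioo (0 : ℝ) 1
  hδ : δ ∈ Set.Ioo (0 : ℝ) 1

namespace Params

/-- The number of iterations. -/
def T (p : Params) : ℕ := ⌊4 * Real.log (1 / p.ε) / p.γ ^ 2⌋₊ + 1

/-- The projection interval. -/
def K (p : Params) : ℕ := ⌈1 / p.γ⌉₊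

/-- The precision of the approximate projections. -/
def ζ (p : Params) : ℝ := p.γ / 4

theorem one_le_cmax (p : Params) : 1 ≤ ((1 - p.γ) ^ p.K)⁻¹ := by
  have h1 := p.hγ.1
  have h2 := p.hγ.2
  exact (one_le_inv₀ (pow_pos (by linarith) _)).2 (pow_le_one₀ (by linarith) (by linarith))

/-- The upper end `1 + ρ = (1 - γ)^{-K}` of the range `[1, 1 + ρ]` of the scaling constant. -/
def cmax (p : Params) : Set.Ici (1 : ℝ) := ⟨((1 - p.γ) ^ p.K)⁻¹, p.one_le_cmax⟩

/-- The number of steps of the binary search, `⌈log₂ (8 ρ / ζ)⌉`. -/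
def searchSteps (p : Params) : ℕ := ⌈Real.logb 2 (8 * (p.cmax - 1) / p.ζ)⌉₊

/-- The dimension of the control register in phase estimation, `O(1 / (ζ √ε))`. -/
def gridSize (p : Params) : ℕ := 64 * (⌈8 / (p.ζ * Real.sqrt p.ε)⌉₊ + 1)

instance (p : Params) : NeZero p.gridSize := ⟨by unfold gridSize; omega⟩

/-- Each mean estimation takes the median of `2 r + 1` runs, where `r = ⌈log (1 / δ')⌉` and
`δ' = δ / (T B)` is its share of the failure probability, for `B` steps of binary search. -/
def repetitions (p : Params) : ℕ := ⌈Real.log (p.T * p.searchSteps / p.δ)⌉₊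

/-- The estimate of the density of the measure `min (1, c N)`. -/
def estimateDensity (p : Params) {m : ℕ} [NeZero m] (N : PosMeasure m) (c : Set.Ici (1 : ℝ)) :
    PMF ℝ :=
  meanEstimation (fun i => (N.scale c i : ℝ)) (fun i => (N.scale c i).2.le)
    (fun i => min_le_left (1 : ℝ) ((c : ℝ) * N i)) p.gridSize p.repetitions

/-- Binary search for a constant `c` such that the density of `min (1, c N)` lies between `ε` and
`(1 + ζ) ε`: `lo` and `hi` are the ends of the current interval, and the estimated density at the
midpoint is compared with `(1 + ζ / 2) ε`. -/
def search (p : Params) {m : ℕ} [NeZero m] (N : PosMeasure m) :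
    ℕ → Set.Ici (1 : ℝ) → Set.Ici (1 : ℝ) → PMF (Set.Ici (1 : ℝ))
  | 0, _, hi => PMF.pure hi
  | k + 1, lo, hi =>
    let mid : Set.Ici (1 : ℝ) := ⟨((lo : ℝ) + hi) / 2, by
      have h1 : (1 : ℝ) ≤ lo := lo.2
      have h2 : (1 : ℝ) ≤ hi := hi.2
      show (1 : ℝ) ≤ ((lo : ℝ) + hi) / 2
      linarith⟩
    (p.estimateDensity N mid).bind fun a =>
      if (1 + p.ζ / 2) * p.ε ≤ a then p.search N k lo mid else p.search N k mid hi

/-- The approximate Bregman projection of `N` onto the measures of density at least `ε`: the measure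
`min (1, c N)` for the constant `c` found by binary search in `[1, 1 + ρ]`. -/
def project (p : Params) {m : ℕ} [NeZero m] (N : PosMeasure m) : PMF (PosMeasure m) :=
  (p.search N p.searchSteps ⟨1, le_refl (1 : ℝ)⟩ p.cmax).map N.scale

/-- The multiplicative update `M (1 - γ)^ℓ`, where the loss `ℓ` is `1` at the examples that `h`
classifies correctly and `0` at the others. -/
def update (p : Params) {m : ℕ} {X : Type*} (S : Fin m → X × Bool) (h : X → Bool)
    (M : PosMeasure m) : PosMeasure m :=
  fun i => ⟨(M i : ℝ) * (1 - p.γ) ^ (if h (S i).1 = (S i).2 then 1 else 0), by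
    have h2 := p.hγ.2
    have hM : (0 : ℝ) < M i := (M i).2
    exact mul_pos hM (pow_pos (by linarith) _)⟩

/-- In iteration `t + 1` the learner is fed examples of the distribution on labelled points that
`M^{t+1} / |M^{t+1}|` induces on the training set, the measure is updated, and it is projected if
`t + 1` is a multiple of `K`. This is the law of the pair consisting of the measure `M^{t+1}` and of
the list of the hypotheses `h_t, …, h_1` after `t` iterations. -/
def iterate (p : Params) {X : Type*} (L : Learner X) {m : ℕ} [NeZero m]
    (S : Fin m → X × Bool) : ℕ → PMF (PosMeasure m × List (X → Bool))
  | 0 => PMF.pure (fun _ => ⟨p.ε, p.hε.1⟩, [])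
  | t + 1 => (p.iterate L S t).bind fun s =>
      (L (s.1.dist.map S)).bind fun h =>
        (if (t + 1) % p.K = 0 then p.project (p.update S h s.1)
          else PMF.pure (p.update S h s.1)).map fun M => (M, h :: s.2)

end Params

/-- The majority vote. -/
def majority {X : Type*} (hs : List (X → Bool)) : X → Bool :=
  fun x => decide (hs.length < 2 * hs.countP fun h => h x)

/-- QuantumBoost with the learner `L` on the training set `S`: the law of the hypothesis that it
outputs. -/
def quantumBoost (p : Params) {X : Type*} (L : Learner X) {m : ℕ} [NeZero m]
    (S : Fin m → X × Bool) : PMF (X → Bool) :=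
  (p.iterate L S p.T).map fun s => majority s.2

theorem half_mem {a : ℝ} (ha : a ∈ Set.Ioo (0 : ℝ) 1) : a / 2 ∈ Set.Ioo (0 : ℝ) 1 :=
  ⟨by linarith [ha.1], by linarith [ha.1, ha.2]⟩

end QBoost

end

/-!
QuantumBoost fits its training sample except with probability `δ / 2`, and a sample is overfitted by
some majority vote of `T` members of `H` with probability at most `δ / 2`. In the next paragraph
`ε` is the accuracy parameter of the algorithm, afterwards it is the bound on the generalization
error.

*Training error.* Amplitude amplification rotates a plane by twice the angle `θ` with `sin² θ` equal
to the mean, so the outcomes of phase estimation are those for the eigenvalues `exp (± 2 i θ)`, whose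
amplitudes decay like the inverse distance to the phase (`phaseEstimation_failure`). Medians make the
failure probability exponentially small (`meanEstimation_failure`), and binary search then yields a
projection of density between `ε` and `(1 + ζ) ε` (`Params.project_failure`). Let `E` be the set of
misclassified examples and suppose that it has at least `ε m` elements. The relative entropy of the
uniform distribution on `E` with respect to `M / |M|` starts at most at `log (1 / ε)`. As the members
of `E` are classified correctly at most half of the time, it falls by at least `γ² / 4` per
iteration on average: the gain from the weak learner exceeds the loss from the inexactness of the
projections (`gain_sub_loss`, `potential_update_le`, `potential_scale_le`). It would be negative
after `T` iterations. Working with the normalized measure is essential, since `|M|` shrinks by a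
constant factor between two projections.

*Generalization.* The class of majority votes has growth function at most `(n + 1) ^ (d T)`. Since
`T` grows with `log (1 / ε)`, an additive deviation bound would lose a logarithmic factor; the
relative bound `relative_deviation` needs only `ε m` to dominate `d T log m`, which leaves room
because `T ≤ a / ε` for a constant `a` depending on `γ`.

This works if `ε² m / d` exceeds a constant `R₀` depending on `γ`. If not, the assumption on `m`
forces `d ≤ 1`. For `d = 0` the target is the only member of `H`. For `d = 1` it forces `ε` and `δ`
to be close to `1` and `m` to be bounded, and uniform convergence says nothing. There a structural
fact helps (`not_fourteen_separated`): a class of VC-dimension one with a weak learner does not have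
`14` points each of which is singled out by a majority vote that is right on it and wrong on the
others. Hence the points on which some majority vote of error more than `1 - η` is right have
probability `q` with `q ^ 14 ≤ 196 η` (`pow_fourteen_le`), and a bounded sample is likely to avoid
all of them.
-/

noncomputable section

namespace QBoost

/-! ### Union bounds for discrete probability laws -/

/-- A failure of `p.bind g` is a failure of `p`, or one of `g x` for some `x` in the good event `G`
of `p`. -/
theorem toOuterMeasure_bind_le {α β : Type*} (p : PMF α) (g : α → PMF β) (G : Set α) (s : Set β)
    {a b : ENNReal} (ha : p.toOuterMeasure Gᶜ ≤ a)
    (hb : ∀ x ∈ p.support, x ∈ G → (g x).toOuterMeasure s ≤ b) :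
    (p.bind g).toOuterMeasure s ≤ a + b := by
  classical
  rw [PMF.toOuterMeasure_bind_apply]
  have h1 : ∀ x, p x * (g x).toOuterMeasure s ≤ Gᶜ.indicator p x + p x * b := by
    intro x
    by_cases hx : x ∈ G
    · by_cases hs : x ∈ p.support
      · exact le_add_left (by gcongr; exact hb x hs hx)
      · rw [PMF.mem_support_iff, not_not] at hs
        simp [hs]
    · refine le_add_right ?_
      rw [Set.indicator_of_mem (by exact hx)]
      have : (g x).toOuterMeasure s ≤ 1 := by
        rw [← (PMF.toOuterMeasure_apply_eq_one_iff (g x) Set.univ).2 (Set.subset_univ _)]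
        exact (g x).toOuterMeasure.mono (Set.subset_univ s)
      calc p x * (g x).toOuterMeasure s ≤ p x * 1 := by gcongr
        _ = p x := mul_one _
  refine (ENNReal.tsum_le_tsum h1).trans ?_
  rw [ENNReal.tsum_add, ENNReal.tsum_mul_right, p.tsum_coe, one_mul, ← PMF.toOuterMeasure_apply]
  gcongr

theorem one_le_toOuterMeasure_add_compl {α : Type*} (p : PMF α) (s : Set α) :
    1 ≤ p.toOuterMeasure s + p.toOuterMeasure sᶜ := by
  rw [← (PMF.toOuterMeasure_apply_eq_one_iff p Set.univ).2 (Set.subset_univ _),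
    ← Set.union_compl_self s]
  exact MeasureTheory.measure_union_le _ _

theorem iid_apply {α : Type*} [Fintype α] (p : PMF α) (k : ℕ) (v : Fin k → α) :
    iid p k v = ∏ i, p (v i) := rfl

theorem sum_iid_mul_prod {α : Type*} [Fintype α] (p : PMF α) (k : ℕ) (g : Fin k → α → ENNReal) :
    ∑ v, iid p k v * ∏ i, g i (v i) = ∏ i, ∑ a, p a * g i a := by
  classical
  rw [Finset.prod_univ_sum, Fintype.piFinset_univ]
  refine Finset.sum_congr rfl fun v _ => ?_
  rw [iid_apply, Finset.prod_mul_distrib]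

theorem iid_toOuterMeasure_pi {α : Type*} [Fintype α] (p : PMF α) (k : ℕ) (B : Fin k → Set α) :
    (iid p k).toOuterMeasure {v | ∀ i, v i ∈ B i} = ∏ i, p.toOuterMeasure (B i) := by
  classical
  have h1 : ∀ i, p.toOuterMeasure (B i) = ∑ a, p a * (B i).indicator 1 a := by
    intro i
    rw [PMF.toOuterMeasure_apply_fintype]
    refine Finset.sum_congr rfl fun a _ => ?_
    by_cases h : a ∈ B i <;> simp [h]
  rw [Finset.prod_congr rfl fun i _ => h1 i, ← sum_iid_mul_prod, PMF.toOuterMeasure_apply_fintype]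
  refine Finset.sum_congr rfl fun v _ => ?_
  by_cases h : ∀ i, v i ∈ B i
  · rw [Set.indicator_of_mem (by exact h), Finset.prod_congr rfl (g := fun _ => 1)
      fun i _ => by rw [Set.indicator_of_mem (h i)]; rfl]
    simp
  · rw [Set.indicator_of_notMem (by exact h)]
    push Not at h
    obtain ⟨i, hi⟩ := h
    rw [Finset.prod_eq_zero (Finset.mem_univ i) (Set.indicator_of_notMem hi _), mul_zero]

/-- The probability that all coordinates in `S` fall into `B`. -/
theorem iid_toOuterMeasure_forall_mem {α : Type*} [Fintype α] (p : PMF α) (k : ℕ)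
    (S : Finset (Fin k)) (B : Set α) :
    (iid p k).toOuterMeasure {v | ∀ i ∈ S, v i ∈ B} = p.toOuterMeasure B ^ S.card := by
  classical
  have h := iid_toOuterMeasure_pi p k fun i => if i ∈ S then B else Set.univ
  have h2 : {v : Fin k → α | ∀ i, v i ∈ (if i ∈ S then B else Set.univ)}
      = {v | ∀ i ∈ S, v i ∈ B} := by
    ext v
    refine forall_congr' fun i => ?_
    by_cases hi : i ∈ S <;> simp [hi]
  rw [h2] at h
  rw [h, Finset.prod_congr rfl (g := fun i => if i ∈ S then p.toOuterMeasure B else 1) fun i _ => by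
    by_cases hi : i ∈ S
    · simp [hi]
    · simp only [hi, if_false]
      exact (PMF.toOuterMeasure_apply_eq_one_iff _ _).2 (Set.subset_univ _)]
  rw [Finset.prod_ite_mem, Finset.univ_inter, Finset.prod_const]

/-! ### The median of independent estimates -/

/-- An odd number of reals more than half of which lie in an interval has its median there. -/
theorem median_mem_Icc {r : ℕ} (a : Fin (2 * r + 1) → ℝ) (l u : ℝ)
    (h : (Finset.univ.filter fun i => a i ∉ Set.Icc l u).card ≤ r) :
    median a ∈ Set.Icc l u := by
  have hm := Tuple.monotone_sort a
  set σ := Tuple.sort a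
  have key : ∀ J : Finset (Fin (2 * r + 1)), r + 1 ≤ J.card →
      ¬ ∀ j ∈ J, a (σ j) ∉ Set.Icc l u := by
    intro J hJ hbad
    have : (J.map σ.toEmbedding).card ≤
        (Finset.univ.filter fun i => a i ∉ Set.Icc l u).card := by
      refine Finset.card_le_card fun i hi => ?_
      obtain ⟨j, hj, rfl⟩ := Finset.mem_map.1 hi
      exact Finset.mem_filter.2 ⟨Finset.mem_univ _, hbad j hj⟩
    rw [Finset.card_map] at this
    omega
  have hmed : median a = a (σ ⟨r, by omega⟩) := rfl
  rw [hmed]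
  constructor
  · by_contra hl
    refine key (Finset.Iic ⟨r, by omega⟩) (by simp) fun j hj hmem => hl ?_
    exact hmem.1.trans (hm (Finset.mem_Iic.1 hj))
  · by_contra hu
    refine key (Finset.Ici ⟨r, by omega⟩) (by simp; omega) fun j hj hmem => hu ?_
    exact (hm (Finset.mem_Ici.1 hj)).trans hmem.2

theorem median_failure {α : Type*} [Fintype α] (p : PMF α) (r : ℕ) (g : α → ℝ) (l u : ℝ)
    {q : ENNReal} (hq : p.toOuterMeasure {a | g a ∉ Set.Icc l u} ≤ q) :
    ((iid p (2 * r + 1)).map fun y => median fun k => g (y k)).toOuterMeasure (Set.Icc l u)ᶜ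
      ≤ 4 ^ r * q ^ (r + 1) := by
  classical
  rw [PMF.toOuterMeasure_map_apply]
  have hsub : ((fun y : Fin (2 * r + 1) → α => median fun k => g (y k)) ⁻¹' (Set.Icc l u)ᶜ) ⊆
      ⋃ S ∈ Finset.powersetCard (r + 1) (Finset.univ : Finset (Fin (2 * r + 1))),
        {v | ∀ i ∈ S, v i ∈ {a | g a ∉ Set.Icc l u}} := by
    intro y hy
    have h1 : ¬ (Finset.univ.filter fun i => g (y i) ∉ Set.Icc l u).card ≤ r :=
      fun h => hy (median_mem_Icc _ l u h)
    obtain ⟨S, hS, hcard⟩ := Finset.exists_subset_card_eq (Nat.succ_le_of_lt (not_le.1 h1))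
    refine Set.mem_iUnion₂.2 ⟨S, Finset.mem_powersetCard.2 ⟨Finset.subset_univ _, hcard⟩, ?_⟩
    exact fun i hi => (Finset.mem_filter.1 (hS hi)).2
  refine ((iid p (2 * r + 1)).toOuterMeasure.mono hsub).trans ?_
  refine (MeasureTheory.measure_biUnion_finset_le (μ := (iid p (2 * r + 1)).toOuterMeasure)
    _ _).trans ?_
  calc _ ≤ ∑ S ∈ Finset.powersetCard (r + 1) (Finset.univ : Finset (Fin (2 * r + 1))),
        q ^ (r + 1) := by
        refine Finset.sum_le_sum fun S hS => ?_
        rw [iid_toOuterMeasure_forall_mem, (Finset.mem_powersetCard.1 hS).2]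
        gcongr
    _ ≤ 4 ^ r * q ^ (r + 1) := by
        rw [Finset.sum_const, Finset.card_powersetCard, Finset.card_univ, Fintype.card_fin,
          nsmul_eq_mul]
        gcongr
        have := Nat.choose_middle_le_pow r
        rw [← Nat.choose_symm_half] at this
        exact_mod_cast this

/-! ### Phase estimation: the tail of the Fejér kernel -/

/-- The amplitude of the outcome `y` when phase estimation with a register of dimension `P` is
applied to an eigenvector with eigenvalue `exp (2 i θ)`. -/
def phaseAmplitude (P : ℕ) (θ : ℝ) (y : Fin P) : ℂ :=
  (P : ℂ)⁻¹ * ∑ j : Fin P, Complex.exp (-(2 * Real.pi * Complex.I * (j : ℕ) * (y : ℕ) / P))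
    * Complex.exp (((2 * (j : ℕ) + 1) * θ : ℝ) * Complex.I)

theorem norm_phaseAmplitude_mul_sin_le (P : ℕ) [NeZero P] (θ : ℝ) (y : Fin P) :
    ‖phaseAmplitude P θ y‖ * (P * |Real.sin (θ - Real.pi * (y : ℕ) / P)|) ≤ 1 := by
  have hP : (P : ℂ) ≠ 0 := Nat.cast_ne_zero.2 (NeZero.ne P)
  have hP' : (0 : ℝ) < P := Nat.cast_pos.2 (Nat.pos_of_ne_zero (NeZero.ne P))
  set u : ℝ := θ - Real.pi * (y : ℕ) / P with hu
  set z : ℂ := Complex.exp (Complex.I * ((2 * u : ℝ) : ℂ)) with hz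
  have h1 : phaseAmplitude P θ y
      = (P : ℂ)⁻¹ * (Complex.exp ((θ : ℝ) * Complex.I) * ∑ j ∈ Finset.range P, z ^ j) := by
    rw [phaseAmplitude, ← Fin.sum_univ_eq_sum_range (fun j : ℕ => z ^ j) P,
      Finset.mul_sum _ _ (Complex.exp _)]
    congr 1
    refine Finset.sum_congr rfl fun j _ => ?_
    rw [hz, ← Complex.exp_nat_mul, ← Complex.exp_add, ← Complex.exp_add]
    congr 1
    rw [hu]
    push_cast
    ring
  have h2 : ‖z - 1‖ = 2 * |Real.sin u| := by
    rw [hz, Complex.norm_exp_I_mul_ofReal_sub_one, Real.norm_eq_abs, abs_mul]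
    congr 2
    · norm_num
    · congr 1; ring
  have hzn : ‖z‖ = 1 := by rw [hz, mul_comm, Complex.norm_exp_ofReal_mul_I]
  have h3 : ‖∑ j ∈ Finset.range P, z ^ j‖ * (2 * |Real.sin u|) ≤ 2 := by
    rw [← h2, ← norm_mul, geom_sum_mul]
    calc ‖z ^ P - 1‖ ≤ ‖z ^ P‖ + ‖(1 : ℂ)‖ := norm_sub_le _ _
      _ = 2 := by rw [norm_pow, hzn]; norm_num
  rw [h1, norm_mul, norm_mul, Complex.norm_exp_ofReal_mul_I, norm_inv, Complex.norm_natCast]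
  have : (P : ℝ)⁻¹ * (1 * ‖∑ j ∈ Finset.range P, z ^ j‖) * (P * |Real.sin u|)
      = ‖∑ j ∈ Finset.range P, z ^ j‖ * |Real.sin u| := by
    field_simp
  rw [this]
  linarith

/-- The amplitude decays like the inverse of the distance on the circle `ℤ / P` between `y` and
`θ P / π`; here `n` is a representative of `y`. -/
theorem norm_phaseAmplitude_sq_le (P : ℕ) [NeZero P] (θ : ℝ) (y : Fin P) (k : ℤ) {d : ℝ}
    (hd : 0 < d) (h1 : |θ * P / Real.pi - (y + P * k)| = d) (h2 : d ≤ P / 2) :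
    ‖phaseAmplitude P θ y‖ ^ 2 ≤ (d ^ 2)⁻¹ / 4 := by
  have hP' : (0 : ℝ) < P := Nat.cast_pos.2 (Nat.pos_of_ne_zero (NeZero.ne P))
  have hpi := Real.pi_pos
  have h3 : |Real.sin (θ - Real.pi * (y : ℕ) / P)|
      = |Real.sin (Real.pi / P * (θ * P / Real.pi - (y + P * k)))| := by
    have : Real.pi / P * (θ * P / Real.pi - (y + P * k))
        = θ - Real.pi * (y : ℕ) / P - k * Real.pi := by
      field_simp
      ring
    rw [this, Real.sin_sub_int_mul_pi, abs_mul]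
    simp
  have h4 : 2 * d / P ≤ |Real.sin (θ - Real.pi * (y : ℕ) / P)| := by
    rw [h3]
    have h5 : |Real.pi / P * (θ * P / Real.pi - (y + P * k))| = Real.pi / P * d := by
      rw [abs_mul, h1, abs_of_pos (by positivity)]
    refine le_trans (le_of_eq ?_) (Real.mul_abs_le_abs_sin ?_)
    · rw [h5]; field_simp
    · rw [h5]
      calc Real.pi / P * d ≤ Real.pi / P * (P / 2) := by gcongr
        _ = Real.pi / 2 := by field_simp
  have h6 := norm_phaseAmplitude_mul_sin_le P θ y
  have h7 : ‖phaseAmplitude P θ y‖ * (2 * d) ≤ 1 := by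
    refine le_trans ?_ h6
    refine mul_le_mul_of_nonneg_left ?_ (norm_nonneg _)
    calc 2 * d = P * (2 * d / P) := by field_simp
      _ ≤ _ := by gcongr
  have h8 : ‖phaseAmplitude P θ y‖ ≤ 1 / (2 * d) := by
    rw [le_div_iff₀ (by positivity)]; exact h7
  calc ‖phaseAmplitude P θ y‖ ^ 2 ≤ (1 / (2 * d)) ^ 2 := by gcongr
    _ = (d ^ 2)⁻¹ / 4 := by field_simp; norm_num

/-- Distances that are at least `7` and pairwise at least `1` apart have distinct integer parts, so
that the sum telescopes. -/
theorem sum_inv_sq_le_of_int_spaced {ι : Type*} (s : Finset ι) (d : ι → ℝ)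
    (h7 : ∀ i ∈ s, 7 ≤ d i) (hd : ∀ i ∈ s, ∀ j ∈ s, i ≠ j → 1 ≤ |d i - d j|) :
    ∑ i ∈ s, (d i ^ 2)⁻¹ ≤ 1 / 6 := by
  classical
  have hinj : Set.InjOn (fun i => ⌊d i⌋₊) s := by
    intro i hi j hj hij
    by_contra hne
    have h := hd i hi j hj hne
    have hi0 : 0 ≤ d i := by linarith [h7 i hi]
    have hj0 : 0 ≤ d j := by linarith [h7 j hj]
    have h1 := Nat.floor_le hi0
    have h2 := Nat.lt_floor_add_one (d i)
    have h3 := Nat.floor_le hj0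
    have h4 := Nat.lt_floor_add_one (d j)
    have h5 : ((⌊d i⌋₊ : ℕ) : ℝ) = (⌊d j⌋₊ : ℕ) := by exact_mod_cast hij
    rw [h5] at h1 h2
    exact absurd h (not_le.2 (abs_lt.2 ⟨by linarith, by linarith⟩))
  have h6 : ∀ i ∈ s, 7 ≤ ⌊d i⌋₊ := fun i hi => Nat.le_floor (by exact_mod_cast h7 i hi)
  set N := s.sup fun i => ⌊d i⌋₊
  calc ∑ i ∈ s, (d i ^ 2)⁻¹ ≤ ∑ i ∈ s, ((⌊d i⌋₊ : ℝ) ^ 2)⁻¹ := by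
        refine Finset.sum_le_sum fun i hi => ?_
        have : (7 : ℝ) ≤ ⌊d i⌋₊ := by exact_mod_cast h6 i hi
        have h2 := Nat.floor_le (show 0 ≤ d i by linarith [h7 i hi])
        gcongr
    _ = ∑ n ∈ s.image fun i => ⌊d i⌋₊, ((n : ℝ) ^ 2)⁻¹ := by
        rw [Finset.sum_image hinj]
    _ ≤ ∑ n ∈ Finset.Ioc 6 (max 6 N), ((n : ℝ) ^ 2)⁻¹ := by
        refine Finset.sum_le_sum_of_subset_of_nonneg (fun n hn => ?_) fun _ _ _ => by positivity
        obtain ⟨i, hi, rfl⟩ := Finset.mem_image.1 hn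
        have : ⌊d i⌋₊ ≤ N := Finset.le_sup (f := fun i => ⌊d i⌋₊) hi
        have := h6 i hi
        simp only [Finset.mem_Ioc]
        omega
    _ ≤ ((6 : ℕ) : ℝ)⁻¹ - ((max 6 N : ℕ) : ℝ)⁻¹ := sum_Ioc_inv_sq_le_sub (by norm_num) (le_max_left _ _)
    _ ≤ 1 / 6 := by
        have : (0 : ℝ) ≤ ((max 6 N : ℕ) : ℝ)⁻¹ := by positivity
        rw [show ((6 : ℕ) : ℝ)⁻¹ = 1 / 6 by norm_num]
        linarith

theorem abs_sin_sq_sub_sin_sq_le (x θ e : ℝ) (h : |x - θ| ≤ e) :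
    |Real.sin x ^ 2 - Real.sin θ ^ 2| ≤ e * (2 * |Real.sin θ| + e) := by
  have h0 : |Real.sin x - Real.sin θ| ≤ e := (Real.abs_sin_sub_sin_le x θ).trans h
  have h1 : |Real.sin x + Real.sin θ| ≤ 2 * |Real.sin θ| + e := by
    calc |Real.sin x + Real.sin θ| = |2 * Real.sin θ + (Real.sin x - Real.sin θ)| := by ring_nf
      _ ≤ |2 * Real.sin θ| + |Real.sin x - Real.sin θ| := abs_add_le _ _
      _ ≤ _ := by rw [abs_mul, abs_two]; linarith
  calc |Real.sin x ^ 2 - Real.sin θ ^ 2|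
      = |Real.sin x - Real.sin θ| * |Real.sin x + Real.sin θ| := by rw [← abs_mul]; ring_nf
    _ ≤ _ := by gcongr; exact (abs_nonneg _).trans h0

/-- Outcomes whose estimate `sin² (π y / P)` is worse than at a distance of seven grid points from
the phase have total probability at most `1 / 12`: they contribute `1 / (4 d²)` for distances
`d > 7` on either side. -/
theorem sum_phaseAmplitude_bad_le (P : ℕ) [NeZero P] (θ : ℝ) (s : Finset (Fin P))
    (hs : ∀ y ∈ s, 7 * Real.pi / P * (2 * |Real.sin θ| + 7 * Real.pi / P)
      < |Real.sin (Real.pi * (y : ℕ) / P) ^ 2 - Real.sin θ ^ 2|) :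
    ∑ y ∈ s, ‖phaseAmplitude P θ y‖ ^ 2 ≤ 1 / 12 := by
  classical
  have hP' : (0 : ℝ) < P := Nat.cast_pos.2 (Nat.pos_of_ne_zero (NeZero.ne P))
  have hpi := Real.pi_pos
  set x := θ * P / Real.pi with hx
  -- the representative of `y` modulo `P` that is closest to `x`
  set k : Fin P → ℤ := fun y => round ((x - (y : ℕ)) / P) with hk
  set n : Fin P → ℝ := fun y => (y : ℕ) + P * (k y) with hn
  have hclose : ∀ y, |x - n y| ≤ P / 2 := by
    intro y
    have h := abs_sub_round ((x - (y : ℕ)) / P)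
    have : x - n y = P * ((x - (y : ℕ)) / P - (k y)) := by
      simp only [hn]; field_simp; ring
    rw [this, abs_mul, abs_of_pos hP']
    calc (P : ℝ) * |(x - (y : ℕ)) / P - (k y)| ≤ P * (1 / 2) := by gcongr
      _ = P / 2 := by ring
  have hfar : ∀ y ∈ s, 7 < |x - n y| := by
    intro y hy
    by_contra hcon
    push Not at hcon
    refine absurd (hs y hy) (not_lt.2 ?_)
    have h1 : Real.sin (Real.pi * (y : ℕ) / P) ^ 2 = Real.sin (Real.pi * n y / P) ^ 2 := by
      have : Real.pi * n y / P = Real.pi * (y : ℕ) / P + (k y) * Real.pi := by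
        simp only [hn]; field_simp
      rw [this, Real.sin_add_int_mul_pi, mul_pow, ← sq_abs ((-1 : ℝ) ^ (k y))]
      simp
    rw [h1]
    apply abs_sin_sq_sub_sin_sq_le
    have : Real.pi * n y / P - θ = -(Real.pi / P * (x - n y)) := by
      rw [hx]; field_simp; ring
    rw [this, abs_neg, abs_mul, abs_of_pos (by positivity)]
    calc Real.pi / P * |x - n y| ≤ Real.pi / P * 7 := by gcongr
      _ = 7 * Real.pi / P := by ring
  have hspaced : ∀ y y' : Fin P, y ≠ y' → 1 ≤ |n y - n y'| := by
    intro y y' hne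
    have h1 : n y - n y' = (((y : ℕ) : ℤ) - ((y' : ℕ) : ℤ) + P * (k y - k y') : ℤ) := by
      simp only [hn]; push_cast; ring
    rw [h1, ← Int.cast_abs]
    have : (1 : ℤ) ≤ |((y : ℕ) : ℤ) - ((y' : ℕ) : ℤ) + P * (k y - k y')| := by
      refine Int.one_le_abs fun h0 => hne ?_
      have hdvd : (P : ℤ) ∣ ((y' : ℕ) : ℤ) - ((y : ℕ) : ℤ) := ⟨k y - k y', by linarith⟩
      have hmod : ((y : ℕ) : ℕ) ≡ (y' : ℕ) [MOD P] := (Nat.modEq_iff_dvd).2 hdvd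
      exact Fin.ext (Nat.ModEq.eq_of_lt_of_lt hmod y.2 y'.2)
    exact_mod_cast this
  have hbound : ∀ y ∈ s, ‖phaseAmplitude P θ y‖ ^ 2 ≤ ((x - n y) ^ 2)⁻¹ / 4 := by
    intro y hy
    have := norm_phaseAmplitude_sq_le P θ y (k y) (d := |x - n y|) (by linarith [hfar y hy]) rfl
      (hclose y)
    rwa [sq_abs] at this
  have hright : ∑ y ∈ s.filter fun y => x < n y, ((n y - x) ^ 2)⁻¹ ≤ 1 / 6 := by
    refine sum_inv_sq_le_of_int_spaced _ _ (fun y hy => ?_) fun y _ y' _ hne => ?_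
    · obtain ⟨h1, h2⟩ := Finset.mem_filter.1 hy
      have := hfar y h1
      rw [abs_sub_comm, abs_of_pos (by linarith)] at this
      exact this.le
    · have := hspaced y y' hne
      rwa [show n y - x - (n y' - x) = n y - n y' by ring]
  have hleft : ∑ y ∈ s.filter fun y => ¬ x < n y, ((x - n y) ^ 2)⁻¹ ≤ 1 / 6 := by
    refine sum_inv_sq_le_of_int_spaced _ _ (fun y hy => ?_) fun y _ y' _ hne => ?_
    · obtain ⟨h1, h2⟩ := Finset.mem_filter.1 hy
      have := hfar y h1
      rw [abs_of_nonneg (by linarith)] at this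
      exact this.le
    · have := hspaced y y' hne
      rwa [show x - n y - (x - n y') = -(n y - n y') by ring, abs_neg]
  calc ∑ y ∈ s, ‖phaseAmplitude P θ y‖ ^ 2 ≤ ∑ y ∈ s, ((x - n y) ^ 2)⁻¹ / 4 :=
        Finset.sum_le_sum hbound
    _ = (∑ y ∈ s.filter fun y => x < n y, ((n y - x) ^ 2)⁻¹) / 4
        + (∑ y ∈ s.filter fun y => ¬ x < n y, ((x - n y) ^ 2)⁻¹) / 4 := by
        rw [← Finset.sum_div, ← add_div, ← Finset.sum_filter_add_sum_filter_not s fun y => x < n y]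
        congr 2
        refine Finset.sum_congr rfl fun y _ => ?_
        rw [show (x - n y) ^ 2 = (n y - x) ^ 2 by ring]
    _ ≤ 1 / 12 := by linarith

/-! ### Amplitude amplification acts as a rotation -/

section Rotation

variable {V : Type*} [NormedAddCommGroup V] [InnerProductSpace ℂ V]

/-- If `Q` rotates the plane spanned by the orthonormal vectors `g, b` by `2 θ`, then the outcomes
of phase estimation on the vector at angle `θ` are those for the two eigenvalues
`exp (± 2 i θ)`, each with weight `1 / 2`. -/
theorem norm_phaseBranch_sq_of_rotation (Q : V ≃ₗᵢ[ℂ] V) {g b ψ : V} (hg : ‖g‖ = 1) (hb : ‖b‖ = 1)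
    (hgb : inner ℂ g b = 0) (θ : ℝ)
    (hψ : ψ = ((Real.sin θ : ℝ) : ℂ) • g + ((Real.cos θ : ℝ) : ℂ) • b)
    (hQg : Q g = ((Real.cos (2 * θ) : ℝ) : ℂ) • g - ((Real.sin (2 * θ) : ℝ) : ℂ) • b)
    (hQb : Q b = ((Real.sin (2 * θ) : ℝ) : ℂ) • g + ((Real.cos (2 * θ) : ℝ) : ℂ) • b)
    (P : ℕ) (y : Fin P) :
    ‖phaseBranch Q ψ P y‖ ^ 2
      = (‖phaseAmplitude P θ y‖ ^ 2 + ‖phaseAmplitude P (-θ) y‖ ^ 2) / 2 := by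
  have hpow : ∀ j : ℕ, (Q ^ j) ψ = ((Real.sin ((2 * j + 1) * θ) : ℝ) : ℂ) • g
      + ((Real.cos ((2 * j + 1) * θ) : ℝ) : ℂ) • b := by
    intro j
    induction j with
    | zero => simp [hψ]
    | succ j ih =>
      rw [pow_succ', LinearIsometryEquiv.coe_mul, Function.comp_apply, ih, map_add, map_smul, map_smul, hQg, hQb]
      have e : ((2 * ((j + 1 : ℕ) : ℝ) + 1) * θ) = (2 * j + 1) * θ + 2 * θ := by push_cast; ring
      rw [e, Real.sin_add, Real.cos_add]
      push_cast
      module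
  set e : Fin P → ℂ := fun j =>
    Complex.exp (-(2 * Real.pi * Complex.I * (j : ℕ) * (y : ℕ) / P)) with he
  set cg : ℂ := (P : ℂ)⁻¹ * ∑ j : Fin P, e j * ((Real.sin ((2 * (j : ℕ) + 1) * θ) : ℝ) : ℂ) with hcg
  set cb : ℂ := (P : ℂ)⁻¹ * ∑ j : Fin P, e j * ((Real.cos ((2 * (j : ℕ) + 1) * θ) : ℝ) : ℂ) with hcb
  have h1 : phaseBranch Q ψ P y = cg • g + cb • b := by
    rw [phaseBranch, hcg, hcb, mul_smul, mul_smul, ← smul_add, Finset.sum_smul, Finset.sum_smul,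
      ← Finset.sum_add_distrib]
    congr 1
    refine Finset.sum_congr rfl fun j _ => ?_
    rw [hpow, smul_add, smul_smul, smul_smul]
  have h2 : ‖phaseBranch Q ψ P y‖ ^ 2 = ‖cg‖ ^ 2 + ‖cb‖ ^ 2 := by
    have := norm_add_sq_eq_norm_sq_add_norm_sq_of_inner_eq_zero (𝕜 := ℂ) (cg • g) (cb • b)
      (by rw [inner_smul_left, inner_smul_right, hgb]; simp)
    rw [h1, sq, this, norm_smul, norm_smul, hg, hb]
    ring
  have h3 : phaseAmplitude P θ y = cb + Complex.I * cg := by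
    rw [phaseAmplitude, hcg, hcb, mul_left_comm, ← mul_add, Finset.mul_sum _ _ Complex.I,
      ← Finset.sum_add_distrib]
    congr 1
    refine Finset.sum_congr rfl fun j _ => ?_
    rw [Complex.exp_mul_I, ← Complex.ofReal_cos, ← Complex.ofReal_sin]
    simp only [he]
    ring
  have h4 : phaseAmplitude P (-θ) y = cb - Complex.I * cg := by
    rw [phaseAmplitude, hcg, hcb, mul_left_comm, ← mul_sub, Finset.mul_sum _ _ Complex.I,
      ← Finset.sum_sub_distrib]
    congr 1
    refine Finset.sum_congr rfl fun j _ => ?_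
    rw [Complex.exp_mul_I, ← Complex.ofReal_cos, ← Complex.ofReal_sin, mul_neg, Real.cos_neg,
      Real.sin_neg]
    simp only [he]
    push_cast
    ring
  have h5 := parallelogram_law_with_norm ℂ cb (Complex.I * cg)
  rw [norm_mul Complex.I cg, Complex.norm_I, one_mul] at h5
  rw [h2, h3, h4]
  nlinarith [h5]

end Rotation

variable {m : ℕ}

/-- The component of a vector in which the last qubit is `c`. -/
def bitPart (c : Bool) (ψ : EuclideanSpace ℂ (Fin m × Bool)) : EuclideanSpace ℂ (Fin m × Bool) :=
  WithLp.toLp 2 fun s => if s.2 = c then ψ s else 0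

theorem bitPart_add_bitPart (ψ : EuclideanSpace ℂ (Fin m × Bool)) :
    bitPart true ψ + bitPart false ψ = ψ := by
  ext s
  rcases s with ⟨i, c⟩
  cases c <;> simp [bitPart]

theorem norm_bitPart_true_sq (v : Fin m → ℝ) (h0 : ∀ i, 0 ≤ v i) :
    ‖bitPart true (meanState v)‖ ^ 2 = (∑ i, v i) / m := by
  rw [EuclideanSpace.norm_sq_eq, Fintype.sum_prod_type, Finset.sum_div]
  refine Finset.sum_congr rfl fun i _ => ?_
  rw [Fintype.sum_bool]
  simp [bitPart, meanState, Complex.norm_real, abs_of_nonneg (Real.sqrt_nonneg _), div_pow,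
    Real.sq_sqrt (h0 i)]

theorem inner_bitPart (ψ φ : EuclideanSpace ℂ (Fin m × Bool)) (h : bitPart true ψ = ψ)
    (h' : bitPart false φ = φ) : inner ℂ ψ φ = 0 := by
  rw [PiLp.inner_apply]
  refine Finset.sum_eq_zero fun s _ => ?_
  rw [← h, ← h']
  rcases s with ⟨i, c⟩
  cases c <;> simp [bitPart]

/-- A unit vector along the component of `ψ`, also if this component vanishes. -/
theorem exists_unit_bitPart [NeZero m] (c : Bool) (ψ : EuclideanSpace ℂ (Fin m × Bool)) :
    ∃ g, ‖g‖ = 1 ∧ bitPart c g = g ∧ bitPart c ψ = ((‖bitPart c ψ‖ : ℝ) : ℂ) • g := by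
  by_cases h : bitPart c ψ = 0
  · refine ⟨EuclideanSpace.single (0, c) 1, by simp, ?_, by rw [h]; simp⟩
    ext s
    simp only [bitPart, PiLp.single_apply]
    by_cases hs : s = (0, c) <;> simp [hs]
  · have hn : ‖bitPart c ψ‖ ≠ 0 := norm_ne_zero_iff.2 h
    have hn' : ((‖bitPart c ψ‖ : ℝ) : ℂ) ≠ 0 := Complex.ofReal_ne_zero.2 hn
    refine ⟨((‖bitPart c ψ‖ : ℝ) : ℂ)⁻¹ • bitPart c ψ, ?_, ?_, ?_⟩
    · rw [norm_smul, norm_inv, Complex.norm_real, norm_norm, inv_mul_cancel₀ hn]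
    · ext s
      simp only [bitPart, PiLp.smul_apply, smul_eq_mul]
      by_cases hs : s.2 = c <;> simp [hs]
    · rw [smul_smul, mul_inv_cancel₀ hn', one_smul]

theorem signFlip_of_true (g : EuclideanSpace ℂ (Fin m × Bool)) (h : bitPart true g = g) :
    signFlip m g = -g := by
  rw [← h]
  ext s
  rcases s with ⟨i, c⟩
  cases c <;> simp [bitPart, signFlip]

theorem signFlip_of_false (g : EuclideanSpace ℂ (Fin m × Bool)) (h : bitPart false g = g) :
    signFlip m g = g := by
  rw [← h]
  ext s
  rcases s with ⟨i, c⟩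
  cases c <;> simp [bitPart, signFlip]

theorem groverOp_apply {ψ : EuclideanSpace ℂ (Fin m × Bool)} (hψ : ‖ψ‖ = 1)
    (φ : EuclideanSpace ℂ (Fin m × Bool)) :
    groverOp ψ φ = (2 * inner ℂ ψ (signFlip m φ)) • ψ - signFlip m φ := by
  rw [groverOp, LinearIsometryEquiv.trans_apply, Submodule.reflection_singleton_apply, hψ, mul_smul]
  simp [two_smul]

/-- Phase estimation of the amplitude amplification operator on the state of `v`: the outcomes are
those for the eigenvalues `exp (± 2 i θ)`, where `sin² θ` is the mean of `v`. -/
theorem exists_norm_phaseBranch_meanState_sq [NeZero m] (v : Fin m → ℝ) (h0 : ∀ i, 0 ≤ v i)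
    (h1 : ∀ i, v i ≤ 1) : ∃ θ : ℝ, |Real.sin θ| = Real.sqrt ((∑ i, v i) / m) ∧
      ∀ (P : ℕ) (y : Fin P), ‖phaseBranch (groverOp (meanState v)) (meanState v) P y‖ ^ 2
        = (‖phaseAmplitude P θ y‖ ^ 2 + ‖phaseAmplitude P (-θ) y‖ ^ 2) / 2 := by
  set ψ := meanState v with hψdef
  have hψ : ‖ψ‖ = 1 := norm_meanState v h0 h1
  obtain ⟨g, hg, hgp, hgψ⟩ := exists_unit_bitPart true ψ
  obtain ⟨b, hb, hbp, hbψ⟩ := exists_unit_bitPart false ψ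
  set s := ‖bitPart true ψ‖ with hs
  set c := ‖bitPart false ψ‖ with hc
  have hgb : inner ℂ g b = 0 := inner_bitPart g b hgp hbp
  have hbg : inner ℂ b g = 0 := by rw [← inner_conj_symm, hgb, map_zero]
  have hgg : inner ℂ g g = (1 : ℂ) := by rw [inner_self_eq_norm_sq_to_K, hg]; simp
  have hbb : inner ℂ b b = (1 : ℂ) := by rw [inner_self_eq_norm_sq_to_K, hb]; simp
  have hdec : ψ = (s : ℂ) • g + (c : ℂ) • b := by
    rw [← hgψ, ← hbψ, bitPart_add_bitPart]
  have hsc : s ^ 2 + c ^ 2 = 1 := by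
    have := norm_add_sq_eq_norm_sq_add_norm_sq_of_inner_eq_zero (𝕜 := ℂ) ((s : ℂ) • g) ((c : ℂ) • b)
      (by rw [inner_smul_left, inner_smul_right, hgb]; simp)
    rw [← hdec, hψ, norm_smul, norm_smul, hg, hb, Complex.norm_real, Complex.norm_real,
      Real.norm_eq_abs, Real.norm_eq_abs] at this
    simp only [mul_one, abs_mul_abs_self] at this
    linarith
  have hs0 : 0 ≤ s := norm_nonneg _
  have hc0 : 0 ≤ c := norm_nonneg _
  have hsinθ : Real.sin (Real.arcsin s) = s := Real.sin_arcsin (by linarith) (by nlinarith)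
  have hcosθ : Real.cos (Real.arcsin s) = c := by
    rw [Real.cos_arcsin, show 1 - s ^ 2 = c ^ 2 by linarith, Real.sqrt_sq hc0]
  refine ⟨Real.arcsin s, ?_, fun P y => norm_phaseBranch_sq_of_rotation (groverOp ψ) hg hb hgb
    (Real.arcsin s) ?_ ?_ ?_ P y⟩
  · rw [hsinθ, abs_of_nonneg hs0, ← norm_bitPart_true_sq v h0, Real.sqrt_sq (norm_nonneg _)]
  · rw [hsinθ, hcosθ]; exact hdec
  · rw [groverOp_apply hψ, signFlip_of_true g hgp, inner_neg_right, Real.cos_two_mul, Real.sin_two_mul,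
      hsinθ, hcosθ]
    have : inner ℂ ψ g = (s : ℂ) := by
      rw [hdec, inner_add_left, inner_smul_left, inner_smul_left, hgg, hbg]; simp
    have hsc' : (s : ℂ) ^ 2 + (c : ℂ) ^ 2 = 1 := by exact_mod_cast hsc
    rw [this, hdec]
    have e : (((2 * c ^ 2 - 1 : ℝ)) : ℂ) = 1 - 2 * (s : ℂ) ^ 2 := by
      push_cast; linear_combination 2 * hsc'
    rw [e]
    push_cast
    module
  · rw [groverOp_apply hψ, signFlip_of_false b hbp, Real.cos_two_mul, Real.sin_two_mul,
      hsinθ, hcosθ]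
    have : inner ℂ ψ b = (c : ℂ) := by
      rw [hdec, inner_add_left, inner_smul_left, inner_smul_left, hgb, hbb]; simp
    rw [this, hdec]
    push_cast
    module

/-- A single run of amplitude estimation has the accuracy of seven grid points with probability at
least `11 / 12`. -/
theorem phaseEstimation_failure [NeZero m] (v : Fin m → ℝ) (h0 : ∀ i, 0 ≤ v i)
    (h1 : ∀ i, v i ≤ 1) (P : ℕ) [NeZero P] {a τ : ℝ} (ha : a = (∑ i, v i) / m)
    (hτ : τ = 7 * Real.pi / P * (2 * Real.sqrt a + 7 * Real.pi / P)) :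
    (phaseEstimation (groverOp (meanState v)) (meanState v) (norm_meanState v h0 h1)
      P).toOuterMeasure
        {y | Real.sin (Real.pi * (y : ℕ) / P) ^ 2 ∉ Set.Icc (a - τ) (a + τ)}
      ≤ ENNReal.ofReal (1 / 12) := by
  classical
  obtain ⟨θ, hθ, hbr⟩ := exists_norm_phaseBranch_meanState_sq v h0 h1
  have ha0 : 0 ≤ a := by
    rw [ha]; exact div_nonneg (Finset.sum_nonneg fun i _ => h0 i) (Nat.cast_nonneg m)
  have hsq : Real.sin θ ^ 2 = a := by
    rw [← sq_abs, hθ, ← ha, Real.sq_sqrt ha0]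
  set bad : Set (Fin P) := {y | Real.sin (Real.pi * (y : ℕ) / P) ^ 2 ∉ Set.Icc (a - τ) (a + τ)}
    with hbad
  have hbad' : ∀ y ∈ Finset.univ.filter (· ∈ bad),
      τ < |Real.sin (Real.pi * (y : ℕ) / P) ^ 2 - a| := by
    intro y hy
    have hy' : Real.sin (Real.pi * (y : ℕ) / P) ^ 2 ∉ Set.Icc (a - τ) (a + τ) :=
      (Finset.mem_filter.1 hy).2
    by_contra hcon
    have := abs_le.1 (not_lt.1 hcon)
    exact hy' ⟨by linarith, by linarith⟩
  have hp := sum_phaseAmplitude_bad_le P θ (Finset.univ.filter (· ∈ bad)) fun y hy => by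
    rw [hsq, hθ, ← ha, ← hτ]; exact hbad' y hy
  have hm := sum_phaseAmplitude_bad_le P (-θ) (Finset.univ.filter (· ∈ bad)) fun y hy => by
    rw [Real.sin_neg, neg_sq, abs_neg, hsq, hθ, ← ha, ← hτ]; exact hbad' y hy
  calc _ = ∑ y ∈ Finset.univ.filter (· ∈ bad),
        ENNReal.ofReal (‖phaseBranch (groverOp (meanState v)) (meanState v) P y‖ ^ 2) := by
        rw [PMF.toOuterMeasure_apply_fintype, Finset.sum_filter]
        refine Finset.sum_congr rfl fun y _ => ?_
        rw [Set.indicator_apply]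
        rfl
    _ = ENNReal.ofReal (∑ y ∈ Finset.univ.filter (· ∈ bad),
        ‖phaseBranch (groverOp (meanState v)) (meanState v) P y‖ ^ 2) :=
        (ENNReal.ofReal_sum_of_nonneg fun _ _ => by positivity).symm
    _ ≤ _ := by
        refine ENNReal.ofReal_le_ofReal ?_
        rw [Finset.sum_congr rfl fun y _ => hbr P y, ← Finset.sum_div, Finset.sum_add_distrib]
        linarith

theorem meanEstimation_failure [NeZero m] (v : Fin m → ℝ) (h0 : ∀ i, 0 ≤ v i)
    (h1 : ∀ i, v i ≤ 1) (P r : ℕ) [NeZero P] {a τ : ℝ} (ha : a = (∑ i, v i) / m)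
    (hτ : τ = 7 * Real.pi / P * (2 * Real.sqrt a + 7 * Real.pi / P)) :
    (meanEstimation v h0 h1 P r).toOuterMeasure (Set.Icc (a - τ) (a + τ))ᶜ
      ≤ ENNReal.ofReal (Real.exp (-r)) := by
  refine (median_failure _ r (fun y : Fin P => Real.sin (Real.pi * (y : ℕ) / P) ^ 2) (a - τ) (a + τ)
    (phaseEstimation_failure v h0 h1 P ha hτ)).trans ?_
  have h4 : (4 : ENNReal) = ENNReal.ofReal 4 := by simp
  rw [h4, ← ENNReal.ofReal_pow (by norm_num), ← ENNReal.ofReal_pow (by norm_num),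
    ← ENNReal.ofReal_mul (by positivity)]
  refine ENNReal.ofReal_le_ofReal ?_
  have he : (1 / 3 : ℝ) ≤ Real.exp (-1) := by
    rw [Real.exp_neg, one_div]
    exact inv_anti₀ (Real.exp_pos _) (by linarith [Real.exp_one_lt_d9])
  calc (4 : ℝ) ^ r * (1 / 12) ^ (r + 1) = (1 / 3) ^ r * (1 / 12) := by
        rw [pow_succ, ← mul_assoc, ← mul_pow]; norm_num
    _ ≤ (1 / 3) ^ r * 1 := by gcongr; norm_num
    _ ≤ Real.exp (-1) ^ r := by rw [mul_one]; gcongr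
    _ = Real.exp (-r) := by rw [← Real.exp_nat_mul]; congr 1; ring

/-! ### The approximate projection -/

/-- The mean of `min (1, c N)`. -/
def density {m : ℕ} (N : PosMeasure m) (c : ℝ) : ℝ := (∑ i, min 1 (c * (N i : ℝ))) / m

theorem density_nonneg {m : ℕ} (N : PosMeasure m) {c : ℝ} (hc : 0 ≤ c) : 0 ≤ density N c :=
  div_nonneg (Finset.sum_nonneg fun i _ => le_min zero_le_one
    (mul_nonneg hc (show (0 : ℝ) < N i from (N i).2).le)) (Nat.cast_nonneg m)

theorem density_le_mul {m : ℕ} (N : PosMeasure m) {b c r : ℝ} (hr : 1 ≤ r) (hbc : c ≤ r * b) :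
    density N c ≤ r * density N b := by
  rw [density, density, ← mul_div_assoc, Finset.mul_sum]
  gcongr with i
  have hN : (0 : ℝ) < N i := (N i).2
  rw [mul_min_of_nonneg _ _ (by linarith)]
  refine min_le_min (by linarith) ?_
  calc c * (N i : ℝ) ≤ (r * b) * N i := by gcongr
    _ = r * (b * N i) := mul_assoc _ _ _

/-- An estimate with the accuracy of amplitude estimation decides correctly between densities below
`q ^ 2` and densities above `(1 + 3 ζ / 4) q ^ 2`. -/
theorem threshold_decides {ζ q s e x : ℝ} (hζ : 0 < ζ) (hζ1 : ζ ≤ 1) (hq : 0 < q) (hs : 0 ≤ s)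
    (he : 0 ≤ e) (hee : e ≤ ζ * q / 20)
    (hx : x ∈ Set.Icc (s ^ 2 - e * (2 * s + e)) (s ^ 2 + e * (2 * s + e))) :
    ((1 + ζ / 2) * q ^ 2 ≤ x → q ^ 2 ≤ s ^ 2) ∧
      (x < (1 + ζ / 2) * q ^ 2 → s ^ 2 ≤ (1 + 3 * ζ / 4) * q ^ 2) := by
  constructor
  · intro h
    by_contra hcon
    have hsq : s < q := lt_of_pow_lt_pow_left₀ 2 hq.le (not_le.1 hcon)
    have h1 : x ≤ (s + e) ^ 2 := by linarith [hx.2, show s ^ 2 + e * (2 * s + e) = (s + e) ^ 2 by ring]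
    have h2 : (s + e) ^ 2 ≤ (q + ζ * q / 20) ^ 2 := by gcongr
    have h3 : (q + ζ * q / 20) ^ 2 < (1 + ζ / 2) * q ^ 2 := by
      have h4 : (1 + ζ / 20) ^ 2 < 1 + ζ / 2 := by nlinarith
      calc (q + ζ * q / 20) ^ 2 = (1 + ζ / 20) ^ 2 * q ^ 2 := by ring
        _ < _ := by gcongr
    linarith
  · intro h
    by_contra hcon
    have hlt := not_le.1 hcon
    have hq2 : 0 < q ^ 2 := by positivity
    have hsq : q < s := by
      refine lt_of_pow_lt_pow_left₀ 2 hs (lt_of_le_of_lt ?_ hlt)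
      nlinarith
    have h1 : e * (2 * s + e) ≤ (ζ * s / 20) * (2 * s + ζ * s / 20) := by
      have : e ≤ ζ * s / 20 := hee.trans (by gcongr)
      gcongr
    have h2 : s ^ 2 * (1 - ζ / 10 - ζ ^ 2 / 400) ≤ x := by
      calc s ^ 2 * (1 - ζ / 10 - ζ ^ 2 / 400) = s ^ 2 - (ζ * s / 20) * (2 * s + ζ * s / 20) := by
            ring
        _ ≤ _ := by linarith [hx.1]
    have h3 : 0 < 1 - ζ / 10 - ζ ^ 2 / 400 := by nlinarith
    have h4 : (1 + 3 * ζ / 4) * q ^ 2 * (1 - ζ / 10 - ζ ^ 2 / 400)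
        ≤ s ^ 2 * (1 - ζ / 10 - ζ ^ 2 / 400) := by gcongr
    have h5 : 1 + ζ / 2 ≤ (1 + 3 * ζ / 4) * (1 - ζ / 10 - ζ ^ 2 / 400) := by
      have hz2 : ζ ^ 2 ≤ ζ := by nlinarith
      have hz3 : ζ ^ 3 ≤ ζ := by nlinarith
      nlinarith
    have h6 : (1 + ζ / 2) * q ^ 2 ≤ (1 + 3 * ζ / 4) * (1 - ζ / 10 - ζ ^ 2 / 400) * q ^ 2 := by
      gcongr
    nlinarith

namespace Params

theorem ζ_pos (p : Params) : 0 < p.ζ := by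
  have := p.hγ.1
  unfold ζ; positivity

theorem ζ_le (p : Params) : p.ζ ≤ 1 / 8 := by
  have := p.hγ.2
  unfold ζ; linarith

theorem T_pos (p : Params) : 0 < p.T := Nat.succ_pos _

/-- The failure probability allotted to a single step of binary search. -/
def stepFailure (p : Params) : ℝ := p.δ / (p.T * p.searchSteps)

theorem exp_neg_repetitions_le (p : Params) (hB : p.searchSteps ≠ 0) :
    Real.exp (-p.repetitions) ≤ p.stepFailure := by
  have hδ := p.hδ.1
  have hT : (0 : ℝ) < p.T := Nat.cast_pos.2 p.T_pos
  have hB' : (0 : ℝ) < p.searchSteps := Nat.cast_pos.2 (Nat.pos_of_ne_zero hB)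
  have h : Real.log (p.T * p.searchSteps / p.δ) ≤ p.repetitions := Nat.le_ceil _
  rw [Real.exp_neg, stepFailure, ← inv_div]
  refine inv_anti₀ (by positivity) ?_
  rwa [← Real.log_le_iff_le_exp (by positivity)]

/-- The estimate `a` of the density of `min (1, c N)` is on the right side of the threshold
`(1 + ζ / 2) ε`, up to a slack of `ζ ε / 2` below and of `ζ ε / 4` above. -/
def Decides (p : Params) {m : ℕ} (N : PosMeasure m) (c a : ℝ) : Prop :=
  ((1 + p.ζ / 2) * p.ε ≤ a → p.ε ≤ density N c) ∧
    (a < (1 + p.ζ / 2) * p.ε → density N c ≤ (1 + 3 * p.ζ / 4) * p.ε)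

theorem estimateDensity_failure (p : Params) {m : ℕ} [NeZero m] (N : PosMeasure m)
    (c : Set.Ici (1 : ℝ)) (hB : p.searchSteps ≠ 0) :
    (p.estimateDensity N c).toOuterMeasure {a | p.Decides N c a}ᶜ
      ≤ ENNReal.ofReal p.stepFailure := by
  have hε := p.hε.1
  have hζ := p.ζ_pos
  have hP : (0 : ℝ) < p.gridSize := Nat.cast_pos.2 (Nat.pos_of_ne_zero (NeZero.ne _))
  have hc : (1 : ℝ) ≤ c := c.2
  set a := density N c with ha
  have ha0 : 0 ≤ a := density_nonneg N (by linarith)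
  set τ := 7 * Real.pi / p.gridSize * (2 * Real.sqrt a + 7 * Real.pi / p.gridSize) with hτ
  have h := meanEstimation_failure (fun i => (N.scale c i : ℝ)) (fun i => (N.scale c i).2.le)
    (fun i => min_le_left (1 : ℝ) ((c : ℝ) * N i)) p.gridSize p.repetitions (a := a) (τ := τ) rfl hτ
  refine le_trans (MeasureTheory.OuterMeasure.mono _ ?_)
    (h.trans (ENNReal.ofReal_le_ofReal (p.exp_neg_repetitions_le hB)))
  refine Set.compl_subset_compl.2 fun x hx => ?_
  have hgrid : 512 / (p.ζ * Real.sqrt p.ε) ≤ p.gridSize := by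
    have h1 : 8 / (p.ζ * Real.sqrt p.ε) ≤ ⌈8 / (p.ζ * Real.sqrt p.ε)⌉₊ := Nat.le_ceil _
    unfold gridSize
    push_cast
    calc 512 / (p.ζ * Real.sqrt p.ε) = 64 * (8 / (p.ζ * Real.sqrt p.ε)) := by ring
      _ ≤ _ := by linarith
  have he : 7 * Real.pi / p.gridSize ≤ p.ζ * Real.sqrt p.ε / 20 := by
    have hq : 0 < Real.sqrt p.ε := Real.sqrt_pos.2 hε
    have hpi := Real.pi_lt_d2
    rw [div_le_iff₀ (by positivity)] at hgrid
    rw [div_le_iff₀ hP]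
    nlinarith
  have hx' : x ∈ Set.Icc (Real.sqrt a ^ 2 - 7 * Real.pi / p.gridSize *
      (2 * Real.sqrt a + 7 * Real.pi / p.gridSize)) (Real.sqrt a ^ 2 + 7 * Real.pi / p.gridSize *
      (2 * Real.sqrt a + 7 * Real.pi / p.gridSize)) := by
    rw [Real.sq_sqrt ha0]; exact hx
  have := threshold_decides hζ (by linarith [p.ζ_le]) (Real.sqrt_pos.2 hε) (Real.sqrt_nonneg a)
    (by positivity) he hx'
  rw [Real.sq_sqrt ha0, Real.sq_sqrt hε.le] at this
  exact this

/-- Binary search keeps the density at most `(1 + 3 ζ / 4) ε` at the lower end of the interval, and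
at least `ε` at its upper end. -/
theorem search_failure (p : Params) {m : ℕ} [NeZero m] (N : PosMeasure m) (hB : p.searchSteps ≠ 0) :
    ∀ (k : ℕ) (lo hi : Set.Ici (1 : ℝ)), (lo : ℝ) ≤ hi →
      density N lo ≤ (1 + 3 * p.ζ / 4) * p.ε → p.ε ≤ density N hi →
      (p.search N k lo hi).toOuterMeasure {c : Set.Ici (1 : ℝ) | p.ε ≤ density N c ∧ (c : ℝ) ≤ hi ∧
        ∃ b : ℝ, 1 ≤ b ∧ b ≤ c ∧ density N b ≤ (1 + 3 * p.ζ / 4) * p.ε ∧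
          (c : ℝ) - b ≤ ((hi : ℝ) - lo) / 2 ^ k}ᶜ ≤ k * ENNReal.ofReal p.stepFailure := by
  intro k
  induction k with
  | zero =>
    intro lo hi hle hlo hhi
    rw [search, Nat.cast_zero, zero_mul, nonpos_iff_eq_zero, PMF.toOuterMeasure_apply_eq_zero_iff,
      PMF.support_pure, Set.disjoint_singleton_left, Set.notMem_compl_iff]
    exact ⟨hhi, le_rfl, lo, lo.2, hle, hlo, by simp⟩
  | succ k ih =>
    intro lo hi hle hlo hhi
    have e : ((k + 1 : ℕ) : ENNReal) * ENNReal.ofReal p.stepFailure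
        = ENNReal.ofReal p.stepFailure + k * ENNReal.ofReal p.stepFailure := by push_cast; ring
    rw [search, e]
    refine toOuterMeasure_bind_le _ _ _ _ (p.estimateDensity_failure N _ hB) fun a _ ha => ?_
    have h1 : (1 : ℝ) ≤ lo := lo.2
    split_ifs with hcase
    · refine le_trans (MeasureTheory.OuterMeasure.mono _ (Set.compl_subset_compl.2 ?_))
        (ih lo _ (show (lo : ℝ) ≤ ((lo : ℝ) + hi) / 2 by linarith) hlo (ha.1 hcase))
      rintro c ⟨hc1, hc2, b, hb1, hb2, hb3, hb4⟩
      have hc2' : (c : ℝ) ≤ ((lo : ℝ) + hi) / 2 := hc2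
      have hb4' : (c : ℝ) - b ≤ (((lo : ℝ) + hi) / 2 - lo) / 2 ^ k := hb4
      refine ⟨hc1, by linarith, b, hb1, hb2, hb3, hb4'.trans (le_of_eq ?_)⟩
      field_simp
      ring
    · refine le_trans (MeasureTheory.OuterMeasure.mono _ (Set.compl_subset_compl.2 ?_))
        (ih _ hi (show ((lo : ℝ) + hi) / 2 ≤ hi by linarith) (ha.2 (not_le.1 hcase)) hhi)
      rintro c ⟨hc1, hc2, b, hb1, hb2, hb3, hb4⟩
      have hb4' : (c : ℝ) - b ≤ ((hi : ℝ) - ((lo : ℝ) + hi) / 2) / 2 ^ k := hb4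
      refine ⟨hc1, hc2, b, hb1, hb2, hb3, hb4'.trans (le_of_eq ?_)⟩
      field_simp
      ring

theorem one_lt_cmax (p : Params) : 1 < (p.cmax : ℝ) := by
  have h1 := p.hγ.1
  have h2 := p.hγ.2
  have hK : p.K ≠ 0 := (Nat.ceil_pos.2 (by positivity)).ne'
  exact (one_lt_inv₀ (pow_pos (by linarith) _)).2 (pow_lt_one₀ (by linarith) (by linarith) hK)

theorem cmax_sub_one_div_le (p : Params) : ((p.cmax : ℝ) - 1) / 2 ^ p.searchSteps ≤ p.ζ / 8 := by
  have hρ := p.one_lt_cmax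
  have hζ := p.ζ_pos
  have h1 : Real.logb 2 (8 * (p.cmax - 1) / p.ζ) ≤ p.searchSteps := Nat.le_ceil _
  have h2 : 0 < 8 * ((p.cmax : ℝ) - 1) / p.ζ := by
    have : 0 < (p.cmax : ℝ) - 1 := by linarith
    positivity
  rw [Real.logb_le_iff_le_rpow (by norm_num) h2, Real.rpow_natCast, div_le_iff₀ hζ] at h1
  rw [div_le_iff₀ (by positivity)]
  linarith

/-- Except with probability `δ / T`, the approximate projection scales `N` to a density between `ε`
and `(1 + ζ) ε`. -/
theorem project_failure (p : Params) {m : ℕ} [NeZero m] (N : PosMeasure m)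
    (hlo : density N 1 ≤ p.ε) (hhi : p.ε ≤ density N p.cmax) :
    (p.project N).toOuterMeasure {M | ∃ c : Set.Ici (1 : ℝ), (c : ℝ) ≤ p.cmax ∧ M = N.scale c ∧
      p.ε ≤ density N c ∧ density N c ≤ (1 + p.ζ) * p.ε}ᶜ ≤ ENNReal.ofReal (p.δ / p.T) := by
  have hε := p.hε.1
  have hζ := p.ζ_pos
  have hζ' := p.ζ_le
  have hρ := p.one_lt_cmax
  have hδ := p.hδ.1
  have hT : (0 : ℝ) < p.T := Nat.cast_pos.2 p.T_pos
  have hB : p.searchSteps ≠ 0 := by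
    have h := p.cmax_sub_one_div_le
    intro h0
    -- without a search step, `ρ ≤ ζ / 8` would follow, but `ρ ≥ γ`
    have h1 := p.hγ.1
    have h2 := p.hγ.2
    have hK : p.K ≠ 0 := (Nat.ceil_pos.2 (by positivity)).ne'
    have h3 : (1 - p.γ) ^ p.K ≤ 1 - p.γ := pow_le_of_le_one (by linarith) (by linarith) hK
    have h4 : (1 - p.γ)⁻¹ ≤ (p.cmax : ℝ) := inv_anti₀ (pow_pos (by linarith) _) h3
    have h5 : 1 + p.γ ≤ (1 - p.γ)⁻¹ := by
      rw [← one_div, le_div_iff₀ (by linarith)]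
      nlinarith
    rw [h0, pow_zero, div_one] at h
    unfold ζ at h
    linarith
  have hB' : (0 : ℝ) < p.searchSteps := Nat.cast_pos.2 (Nat.pos_of_ne_zero hB)
  have h := p.search_failure N hB p.searchSteps ⟨1, le_refl (1 : ℝ)⟩ p.cmax hρ.le
    (show density N 1 ≤ _ by nlinarith) hhi
  rw [project, PMF.toOuterMeasure_map_apply]
  refine le_trans (MeasureTheory.OuterMeasure.mono _ ?_) (h.trans (le_of_eq ?_))
  · rintro c hc ⟨hc1, hc2, b, hb1, hb2, hb3, hb4⟩
    refine hc ⟨c, hc2, rfl, hc1, ?_⟩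
    have hcb : (c : ℝ) - b ≤ p.ζ / 8 := hb4.trans p.cmax_sub_one_div_le
    calc density N c ≤ (1 + p.ζ / 8) * density N b :=
          density_le_mul N (by linarith) (by nlinarith)
      _ ≤ (1 + p.ζ / 8) * ((1 + 3 * p.ζ / 4) * p.ε) := by gcongr
      _ = ((1 + p.ζ / 8) * (1 + 3 * p.ζ / 4)) * p.ε := by ring
      _ ≤ (1 + p.ζ) * p.ε := by gcongr; nlinarith
  · rw [← ENNReal.ofReal_natCast, ← ENNReal.ofReal_mul (by positivity), stepFailure]
    congr 1
    field_simp

end Params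

/-! ### The relative entropy potential -/

section Potential

variable {m : ℕ}

/-- Up to an additive `log |E|`, this is the relative entropy of the uniform distribution on `E`
with respect to the normalization of `M`. -/
def potential (M : Fin m → ℝ) (E : Finset (Fin m)) : ℝ :=
  Real.log (∑ i, M i) - (∑ i ∈ E, Real.log (M i)) / E.card

/-- Nonnegativity of the relative entropy. -/
theorem log_card_le_potential (M : Fin m → ℝ) (hM : ∀ i, 0 < M i) (E : Finset (Fin m))
    (hE : E.Nonempty) : Real.log E.card ≤ potential M E := by
  have hn : (0 : ℝ) < E.card := Nat.cast_pos.2 hE.card_pos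
  have hS : 0 < ∑ i, M i := by
    obtain ⟨i, _⟩ := hE
    exact Finset.sum_pos (fun i _ => hM i) ⟨i, Finset.mem_univ i⟩
  have h1 : ∀ i ∈ E, Real.log (M i) + Real.log E.card - Real.log (∑ i, M i)
      ≤ M i * E.card / (∑ i, M i) - 1 := by
    intro i _
    rw [← Real.log_mul (hM i).ne' hn.ne', ← Real.log_div (mul_pos (hM i) hn).ne' hS.ne']
    exact Real.log_le_sub_one_of_pos (div_pos (mul_pos (hM i) hn) hS)
  have h2 := Finset.sum_le_sum h1
  simp only [Finset.sum_sub_distrib, Finset.sum_add_distrib, Finset.sum_const, nsmul_eq_mul,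
    mul_one] at h2
  have h3 : ∑ i ∈ E, M i * E.card / (∑ i, M i) ≤ E.card := by
    rw [← Finset.sum_div, ← Finset.sum_mul, div_le_iff₀ hS, mul_comm]
    gcongr
    · exact fun i _ _ => (hM i).le
    · exact Finset.subset_univ E
  rw [potential, le_sub_iff_add_le, ← le_sub_iff_add_le', div_le_iff₀ hn]
  linarith

theorem sum_update_le (M ℓ : Fin m → ℝ) {γ : ℝ} (hγ : 0 < γ)
    (hadv : (1 / 2 + γ) * ∑ i, M i ≤ ∑ i, M i * ℓ i) :
    ∑ i, M i * (1 - γ * ℓ i) ≤ (1 - γ * (1 / 2 + γ)) * ∑ i, M i := by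
  have : ∑ i, M i * (1 - γ * ℓ i) = ∑ i, M i - γ * ∑ i, M i * ℓ i := by
    rw [Finset.mul_sum, ← Finset.sum_sub_distrib]
    exact Finset.sum_congr rfl fun i _ => by ring
  rw [this]
  nlinarith

/-- The change of the potential under a multiplicative update. -/
theorem potential_update_le (M N ℓ : Fin m → ℝ) (hM : ∀ i, 0 < M i) {γ : ℝ} (hγ : 0 < γ)
    (hγ2 : γ < 1 / 2) (hℓ : ∀ i, ℓ i = 0 ∨ ℓ i = 1) (hN : ∀ i, N i = M i * (1 - γ * ℓ i))
    (hadv : (1 / 2 + γ) * ∑ i, M i ≤ ∑ i, M i * ℓ i)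
    (E : Finset (Fin m)) (hE : E.Nonempty) :
    potential N E ≤ potential M E + Real.log (1 - γ * (1 / 2 + γ))
      - Real.log (1 - γ) * ((∑ i ∈ E, ℓ i) / E.card) := by
  have hS : 0 < ∑ i, M i := by
    obtain ⟨i, _⟩ := hE
    exact Finset.sum_pos (fun i _ => hM i) ⟨i, Finset.mem_univ i⟩
  have hNpos : ∀ i, 0 < N i := by
    intro i
    rw [hN]
    rcases hℓ i with h | h <;> rw [h] <;> refine mul_pos (hM i) (by linarith)
  have hSN : 0 < ∑ i, N i := by
    obtain ⟨i, _⟩ := hE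
    exact Finset.sum_pos (fun i _ => hNpos i) ⟨i, Finset.mem_univ i⟩
  have hu : 0 < 1 - γ * (1 / 2 + γ) := by nlinarith
  have h1 : Real.log (∑ i, N i) ≤ Real.log (∑ i, M i) + Real.log (1 - γ * (1 / 2 + γ)) := by
    rw [add_comm, ← Real.log_mul hu.ne' hS.ne']
    refine Real.log_le_log hSN ?_
    rw [Finset.sum_congr rfl fun i _ => hN i]
    exact sum_update_le M ℓ hγ hadv
  have h2 : ∑ i ∈ E, Real.log (N i) = ∑ i ∈ E, Real.log (M i) + Real.log (1 - γ) * ∑ i ∈ E, ℓ i := by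
    rw [Finset.mul_sum, ← Finset.sum_add_distrib]
    refine Finset.sum_congr rfl fun i _ => ?_
    rw [hN]
    rcases hℓ i with h | h
    · rw [h]; simp
    · rw [h, mul_one, mul_one, Real.log_mul (hM i).ne' (by linarith)]
  rw [potential, potential, h2, add_div, mul_div_assoc]
  linarith

/-- The log-sum inequality. -/
theorem sum_mul_log_sub_log_ge (M N : Fin m → ℝ) (hM : ∀ i, 0 < M i) (hN : ∀ i, 0 < N i) :
    (∑ i, M i) * (Real.log (∑ i, M i) - Real.log (∑ i, N i))
      ≤ ∑ i, M i * (Real.log (M i) - Real.log (N i)) := by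
  rcases isEmpty_or_nonempty (Fin m) with h | h
  · simp
  have hA : 0 < ∑ i, M i := Finset.sum_pos (fun i _ => hM i) Finset.univ_nonempty
  have hB : 0 < ∑ i, N i := Finset.sum_pos (fun i _ => hN i) Finset.univ_nonempty
  set A := ∑ i, M i
  set B := ∑ i, N i
  have h1 : ∀ i, M i * (Real.log (N i) - Real.log (M i) + (Real.log A - Real.log B))
      ≤ N i * A / B - M i := by
    intro i
    have e : Real.log (N i) - Real.log (M i) + (Real.log A - Real.log B)
        = Real.log (N i / M i * (A / B)) := by
      rw [Real.log_mul (div_pos (hN i) (hM i)).ne' (div_pos hA hB).ne',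
        Real.log_div (hN i).ne' (hM i).ne', Real.log_div hA.ne' hB.ne']
    have h2 := Real.log_le_sub_one_of_pos
      (mul_pos (div_pos (hN i) (hM i)) (div_pos hA hB))
    rw [← e] at h2
    refine (mul_le_mul_of_nonneg_left h2 (hM i).le).trans (le_of_eq ?_)
    have := (hM i).ne'
    field_simp
  have h3 := Finset.sum_le_sum fun i (_ : i ∈ Finset.univ) => h1 i
  rw [Finset.sum_sub_distrib, ← Finset.sum_div, ← Finset.sum_mul,
    show B * A / B = A by field_simp, sub_self] at h3
  have h4 : ∑ i, M i * (Real.log (N i) - Real.log (M i) + (Real.log A - Real.log B))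
      = A * (Real.log A - Real.log B) - ∑ i, M i * (Real.log (M i) - Real.log (N i)) := by
    rw [Finset.sum_mul, ← Finset.sum_sub_distrib]
    exact Finset.sum_congr rfl fun i _ => by ring
  linarith

/-- A projection that overshoots the density `ε` by a factor of at most `1 + ζ` increases the
potential by at most `ζ` times the logarithm of the scaling constant. This is the Pythagorean
inequality for Bregman projections, in a form that allows for an inexact projection. -/
theorem potential_scale_le (M N : Fin m → ℝ) (hN : ∀ i, 0 < N i) (hN1 : ∀ i, N i ≤ 1) {c ε ζ : ℝ}
    (hc : 1 ≤ c) (hMN : ∀ i, M i = min 1 (c * N i)) (hε : 0 < ε)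
    (hlo : ε ≤ ∑ i, M i) (hhi : ∑ i, M i ≤ (1 + ζ) * ε)
    (E : Finset (Fin m)) (hE : E.Nonempty) (hEε : ε ≤ E.card) :
    potential M E ≤ potential N E + ζ * Real.log c := by
  have hc0 : 0 < c := by linarith
  have hM : ∀ i, 0 < M i := fun i => by rw [hMN]; exact lt_min one_pos (mul_pos hc0 (hN i))
  have hn : (0 : ℝ) < E.card := Nat.cast_pos.2 hE.card_pos
  have hA : 0 < ∑ i, M i := by linarith
  have hB : 0 < ∑ i, N i := by
    obtain ⟨i, _⟩ := hE
    exact Finset.sum_pos (fun i _ => hN i) ⟨i, Finset.mem_univ i⟩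
  have hlogsum := sum_mul_log_sub_log_ge M N hM hN
  set A := ∑ i, M i with hAdef
  set B := ∑ i, N i with hBdef
  set l := Real.log c with hl
  set τ : Fin m → ℝ := fun i => Real.log (M i) - Real.log (N i) - l with hτ
  have hτ0 : ∀ i, τ i ≤ 0 := by
    intro i
    have : Real.log (M i) ≤ l + Real.log (N i) := by
      rw [hl, ← Real.log_mul hc0.ne' (hN i).ne']
      exact Real.log_le_log (hM i) (by rw [hMN]; exact min_le_right _ _)
    simp only [hτ]; linarith
  -- a nonzero `τ i` means that the minimum is attained by `1`
  have hτM : ∀ i, M i * τ i = τ i := by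
    intro i
    rcases le_total 1 (c * N i) with h | h
    · rw [hMN, min_eq_left h, one_mul]
    · have : τ i = 0 := by
        simp only [hτ]
        rw [hMN, min_eq_right h, Real.log_mul hc0.ne' (hN i).ne']
        ring
      rw [this, mul_zero]
  have hsumτ : A * (Real.log A - Real.log B - l) ≤ ∑ i, τ i := by
    rw [← Finset.sum_congr rfl fun i _ => hτM i]
    have : ∑ i, M i * τ i = ∑ i, M i * (Real.log (M i) - Real.log (N i)) - A * l := by
      rw [hAdef, Finset.sum_mul, ← Finset.sum_sub_distrib]
      exact Finset.sum_congr rfl fun i _ => by simp only [hτ]; ring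
    linarith
  have hEτ : ∑ i, τ i ≤ ∑ i ∈ E, τ i := by
    have h1 := Finset.sum_add_sum_compl E τ
    have h2 : ∑ i ∈ Eᶜ, τ i ≤ 0 := Finset.sum_nonpos fun i _ => hτ0 i
    linarith
  have hE0 : ∑ i ∈ E, τ i ≤ 0 := Finset.sum_nonpos fun i _ => hτ0 i
  have hAB1 : Real.log B ≤ Real.log A := by
    refine Real.log_le_log hB (Finset.sum_le_sum fun i _ => ?_)
    rw [hMN]
    exact le_min (hN1 i) (by nlinarith [hN i])
  have hAB2 : Real.log A ≤ l + Real.log B := by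
    rw [hl, ← Real.log_mul hc0.ne' hB.ne']
    refine Real.log_le_log hA ?_
    rw [hAdef, hBdef, Finset.mul_sum]
    exact Finset.sum_le_sum fun i _ => by rw [hMN]; exact min_le_right _ _
  -- the average of `τ` over `E`
  have havg : A / ε * (Real.log A - Real.log B - l) ≤ (∑ i ∈ E, τ i) / E.card := by
    have h1 : (∑ i ∈ E, τ i) / ε ≤ (∑ i ∈ E, τ i) / E.card := by
      rw [div_le_div_iff₀ hε hn]
      nlinarith
    refine le_trans ?_ h1
    rw [div_mul_eq_mul_div]
    gcongr
    linarith
  have hdiff : (∑ i ∈ E, Real.log (M i)) / E.card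
      = (∑ i ∈ E, Real.log (N i)) / E.card + l + (∑ i ∈ E, τ i) / E.card := by
    simp only [hτ, Finset.sum_sub_distrib, Finset.sum_const, nsmul_eq_mul]
    field_simp
    ring
  rw [potential, potential, hdiff]
  have h1 : 1 ≤ A / ε := (one_le_div hε).2 hlo
  have h2 : A / ε ≤ 1 + ζ := by rw [div_le_iff₀ hε]; exact hhi
  have h3 : (A / ε - 1) * (l + Real.log B - Real.log A) ≤ ζ * l := by
    apply mul_le_mul <;> linarith
  nlinarith

end Potential

/-! ### Majority votes and empirical errors -/

/-- Half of the hypotheses at most are right where the majority vote is wrong. -/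
theorem two_mul_countP_le_of_majority_ne {X : Type*} (hs : List (X → Bool)) (x : X) (y : Bool)
    (h : majority hs x ≠ y) : 2 * hs.countP (fun h => decide (h x = y)) ≤ hs.length := by
  cases y with
  | true =>
    simp only [majority, ne_eq, decide_eq_true_eq, not_lt] at h
    simpa using h
  | false =>
    simp only [majority, ne_eq, Bool.not_eq_false, decide_eq_true_eq] at h
    have h1 := List.length_eq_countP_add_countP (fun h : X → Bool => h x) (l := hs)
    have h2 : hs.countP (fun h => decide (h x = false))
        = hs.countP (fun a => decide ¬ a x = true) := by
      refine List.countP_congr fun a _ => ?_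
      cases a x <;> simp
    omega

theorem PosMeasure.sum_pos {m : ℕ} [NeZero m] (M : PosMeasure m) : 0 < ∑ i, (M i : ℝ) :=
  Finset.sum_pos (fun i _ => (M i).2) Finset.univ_nonempty

theorem PosMeasure.dist_apply {m : ℕ} [NeZero m] (M : PosMeasure m) (i : Fin m) :
    M.dist i = ENNReal.ofReal (M i / ∑ j, (M j : ℝ)) := by
  rw [PosMeasure.dist, PMF.normalize_apply, tsum_fintype,
    ← ENNReal.ofReal_sum_of_nonneg fun j _ => (show (0 : ℝ) < M j from (M j).2).le, div_eq_mul_inv,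
    ENNReal.ofReal_mul (show (0 : ℝ) < M i from (M i).2).le, ENNReal.ofReal_inv_of_pos M.sum_pos]

theorem toReal_toOuterMeasure {α : Type*} [Fintype α] (p : PMF α) (s : Set α)
    [DecidablePred (· ∈ s)] :
    (p.toOuterMeasure s).toReal = ∑ a, if a ∈ s then (p a).toReal else 0 := by
  rw [PMF.toOuterMeasure_apply_fintype, ENNReal.toReal_sum]
  · refine Finset.sum_congr rfl fun a _ => ?_
    by_cases h : a ∈ s <;> simp [h]
  · intro a _
    by_cases h : a ∈ s <;> simp [h, p.apply_ne_top]

theorem err_map_dist {X : Type*} {m : ℕ} [NeZero m] (M : PosMeasure m) (x : Fin m → X)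
    (f h : X → Bool) :
    err (M.dist.map x) f h
      = (∑ i, (M i : ℝ) * (if h (x i) = f (x i) then 0 else 1)) / ∑ i, (M i : ℝ) := by
  classical
  rw [err, PMF.toOuterMeasure_map_apply, toReal_toOuterMeasure, Finset.sum_div]
  refine Finset.sum_congr rfl fun i _ => ?_
  rw [PosMeasure.dist_apply, ENNReal.toReal_ofReal
    (div_nonneg (show (0 : ℝ) < M i from (M i).2).le M.sum_pos.le)]
  by_cases hi : h (x i) = f (x i) <;> simp [hi]

/-- The advantage of a weak learner that is fed the normalization of `M`. -/
theorem IsWeakLearner.advantage {X : Type*} {γ : ℝ} {C : Set (X → Bool)} {H : Finset (X → Bool)}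
    {L : Learner X} (hL : IsWeakLearner γ C H L) {f : X → Bool} (hf : f ∈ C) {m : ℕ} [NeZero m]
    (M : PosMeasure m) (x : Fin m → X) {h : X → Bool}
    (hh : h ∈ (L (M.dist.map fun i => labelled f (x i))).support) :
    h ∈ H ∧ (1 / 2 + γ) * ∑ i, (M i : ℝ)
      ≤ ∑ i, (M i : ℝ) * (if h (x i) = f (x i) then 1 else 0) := by
  have hcomp : (M.dist.map fun i => labelled f (x i)) = (M.dist.map x).map (labelled f) := by
    rw [PMF.map_comp]; rfl
  rw [hcomp] at hh
  obtain ⟨h1, h2⟩ := hL f hf _ h hh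
  refine ⟨h1, ?_⟩
  rw [err_map_dist, div_le_iff₀ M.sum_pos] at h2
  have h3 : ∑ i, (M i : ℝ) * (if h (x i) = f (x i) then 1 else 0)
      + ∑ i, (M i : ℝ) * (if h (x i) = f (x i) then 0 else 1) = ∑ i, (M i : ℝ) := by
    rw [← Finset.sum_add_distrib]
    refine Finset.sum_congr rfl fun i _ => ?_
    split_ifs <;> ring
  linarith

/-! ### The training error of QuantumBoost -/

/-- In each iteration the gain `-log (1 - γ (1/2 + γ))` from the advantage of the weak learner
exceeds the loss on a set of examples that are classified correctly half of the time, together with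
the loss `ζ log (1 / (1 - γ))` from the inexact projections. -/
theorem gain_sub_loss {γ : ℝ} (h0 : 0 < γ) (h2 : γ < 1 / 2) :
    Real.log (1 - γ * (1 / 2 + γ)) - Real.log (1 - γ) * (1 / 2 + γ / 4) ≤ -(γ ^ 2 / 4) := by
  have hγ1 : 0 < 1 - γ := by linarith
  set u := γ * (1 / 2 + γ) with hu
  have hu0 : 0 < u := by positivity
  have hu1 : 0 < 1 - u := by nlinarith
  -- `t ≤ sinh t` at `t = -log (1 - γ)`
  have hL : -Real.log (1 - γ) ≤ γ * (2 - γ) / (2 * (1 - γ)) := by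
    have h := Real.self_le_sinh_iff.2 (Real.log_nonneg ((one_le_inv₀ hγ1).2 (by linarith)))
    rw [Real.sinh_log (inv_pos.2 hγ1), Real.log_inv, inv_inv] at h
    refine h.trans (le_of_eq ?_)
    field_simp
    ring
  have hlog : Real.log (1 - u) ≤ -(u + u ^ 2 / 2) := by
    have h := Real.le_log_one_add_of_nonneg (div_pos hu0 hu1).le
    have e : 1 + u / (1 - u) = (1 - u)⁻¹ := by field_simp; ring
    rw [e, Real.log_inv] at h
    have h3 : u + u ^ 2 / 2 ≤ 2 * (u / (1 - u)) / (u / (1 - u) + 2) := by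
      have e2 : 2 * (u / (1 - u)) / (u / (1 - u) + 2) = 2 * u / (2 - u) := by
        have : 2 - u ≠ 0 := by linarith
        have : u / (1 - u) + 2 = (2 - u) / (1 - u) := by field_simp; ring
        rw [this]
        field_simp
      rw [e2, le_div_iff₀ (by linarith)]
      nlinarith [pow_pos hu0 3]
    linarith
  have hpoly : γ * (2 - γ) / (2 * (1 - γ)) * (1 / 2 + γ / 4) ≤ u + u ^ 2 / 2 - γ ^ 2 / 4 := by
    rw [div_mul_eq_mul_div, div_le_iff₀ (by linarith), hu]
    have h4 : 0 ≤ γ ^ 2 * (3 - 2 * γ - 4 * γ ^ 3) := by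
      refine mul_nonneg (by positivity) ?_
      have : γ ^ 3 ≤ (1 / 2) ^ 3 := by gcongr
      linarith
    nlinarith
  have h5 : -Real.log (1 - γ) * (1 / 2 + γ / 4)
      ≤ γ * (2 - γ) / (2 * (1 - γ)) * (1 / 2 + γ / 4) := by gcongr
  linarith

namespace Params

theorem log_cmax (p : Params) : Real.log p.cmax = p.K * -Real.log (1 - p.γ) := by
  change Real.log ((1 - p.γ) ^ p.K)⁻¹ = _
  rw [Real.log_inv, Real.log_pow]
  ring

theorem two_le_K (p : Params) : 2 ≤ p.K := by
  have h0 := p.hγ.1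
  have h1 := p.hγ.2
  have h2 : (2 : ℝ) ≤ 1 / p.γ := by rw [le_div_iff₀ h0]; linarith
  exact_mod_cast h2.trans (Nat.le_ceil (1 / p.γ))

/-- The state of QuantumBoost after `t` iterations in which no projection has failed. The fifth
property says that rescaling by `(1 - γ)^{-K}` will restore the density `ε` at the end of the
current window of `K` iterations. -/
structure Invariant (p : Params) {X : Type*} (H : Finset (X → Bool)) {m : ℕ}
    (S : Fin m → X × Bool) (t : ℕ) (s : PosMeasure m × List (X → Bool)) : Prop where
  length_eq : s.2.length = t
  mem : ∀ h ∈ s.2, h ∈ H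
  le_one : ∀ i, (s.1 i : ℝ) ≤ 1
  sum_le : ∑ i, (s.1 i : ℝ) ≤ (1 + p.ζ) * (p.ε * m)
  le_sum : p.ε * m ≤ ∑ i, min 1 (((1 - p.γ) ^ (t % p.K))⁻¹ * (s.1 i : ℝ))
  potential_le : ∀ E : Finset (Fin m), E.Nonempty → p.ε * m ≤ E.card →
    potential (fun i => (s.1 i : ℝ)) E ≤ Real.log m + t * Real.log (1 - p.γ * (1 / 2 + p.γ))
      - Real.log (1 - p.γ) * ((∑ i ∈ E,
          (s.2.countP (fun h => decide (h (S i).1 = (S i).2)) : ℝ)) / E.card)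
      + p.ζ * Real.log p.cmax * (t / p.K : ℕ)

theorem invariant_zero (p : Params) {X : Type*} (H : Finset (X → Bool)) {m : ℕ} [NeZero m]
    (S : Fin m → X × Bool) : p.Invariant H S 0 (fun _ => ⟨p.ε, p.hε.1⟩, []) where
  length_eq := rfl
  mem := by simp
  le_one := fun _ => p.hε.2.le
  sum_le := by
    have := mul_nonneg p.ζ_pos.le (mul_nonneg p.hε.1.le (Nat.cast_nonneg (α := ℝ) m))
    simp only [Finset.sum_const, Finset.card_univ, Fintype.card_fin, nsmul_eq_mul]
    linarith
  le_sum := by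
    simp only [Nat.zero_mod, pow_zero, inv_one, one_mul, min_eq_right p.hε.2.le, Finset.sum_const,
      Finset.card_univ, Fintype.card_fin, nsmul_eq_mul]
    exact (mul_comm _ _).le
  potential_le := by
    intro E hE _
    have hn : (E.card : ℝ) ≠ 0 := Nat.cast_ne_zero.2 hE.card_pos.ne'
    have hm : (m : ℝ) ≠ 0 := Nat.cast_ne_zero.2 (NeZero.ne m)
    simp only [potential, Finset.sum_const, Finset.card_univ, Fintype.card_fin, nsmul_eq_mul]
    rw [Real.log_mul hm p.hε.1.ne']
    simp [hn]

section Step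

variable (p : Params) {X : Type*} {C : Set (X → Bool)} {H : Finset (X → Bool)} {L : Learner X}
  (hL : IsWeakLearner p.γ C H L) {f : X → Bool} (hf : f ∈ C) {m : ℕ} [NeZero m] (x : Fin m → X)
  {t : ℕ} {s : PosMeasure m × List (X → Bool)}
  (hs : p.Invariant H (fun i => labelled f (x i)) t s) {h : X → Bool}
  (hh : h ∈ (L (s.1.dist.map fun i => labelled f (x i))).support)

include hL hf hs hh

/-- What holds after the multiplicative update, whether or not a projection follows. -/
theorem update_properties :
    (∀ g ∈ h :: s.2, g ∈ H) ∧
    (∀ i, (p.update (fun i => labelled f (x i)) h s.1 i : ℝ) ≤ s.1 i) ∧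
    (∀ i, (1 - p.γ) * s.1 i ≤ (p.update (fun i => labelled f (x i)) h s.1 i : ℝ)) ∧
    ∑ i, (p.update (fun i => labelled f (x i)) h s.1 i : ℝ) ≤ p.ε * m ∧
    ∀ E : Finset (Fin m), E.Nonempty → p.ε * m ≤ E.card →
    potential (fun i => (p.update (fun i => labelled f (x i)) h s.1 i : ℝ)) E
      ≤ Real.log m + (t + 1 : ℕ) * Real.log (1 - p.γ * (1 / 2 + p.γ))
      - Real.log (1 - p.γ) * ((∑ i ∈ E,
          ((h :: s.2).countP (fun h => decide (h (x i) = f (x i))) : ℝ)) / E.card)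
      + p.ζ * Real.log p.cmax * (t / p.K : ℕ) := by
  have h0 := p.hγ.1
  have h2 := p.hγ.2
  obtain ⟨hH, hadv⟩ := hL.advantage hf s.1 x hh
  set ℓ : Fin m → ℝ := fun i => if h (x i) = f (x i) then 1 else 0 with hℓ
  set N := p.update (fun i => labelled f (x i)) h s.1 with hN
  have hNi : ∀ i, (N i : ℝ) = s.1 i * (1 - p.γ * ℓ i) := by
    intro i
    change (s.1 i : ℝ) * (1 - p.γ) ^ (if h (x i) = f (x i) then 1 else 0) = _
    simp only [hℓ]
    split_ifs <;> simp
  have hpos : ∀ i, (0 : ℝ) < s.1 i := fun i => (s.1 i).2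
  have hℓ01 : ∀ i, ℓ i = 0 ∨ ℓ i = 1 := by
    intro i
    simp only [hℓ]
    split_ifs <;> simp
  refine ⟨?_, ?_, ?_, ?_, ?_⟩
  · intro g hg
    rcases List.mem_cons.1 hg with rfl | hg
    · exact hH
    · exact hs.mem g hg
  · intro i
    rw [hNi]
    have := hpos i
    rcases hℓ01 i with h | h <;> rw [h] <;> nlinarith
  · intro i
    rw [hNi]
    have := hpos i
    rcases hℓ01 i with h | h <;> rw [h] <;> nlinarith
  · rw [Finset.sum_congr rfl fun i _ => hNi i]
    refine (sum_update_le _ ℓ h0 hadv).trans ?_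
    have hu : 0 ≤ 1 - p.γ * (1 / 2 + p.γ) := by nlinarith
    have hεm : 0 ≤ p.ε * m := mul_nonneg p.hε.1.le (Nat.cast_nonneg m)
    calc (1 - p.γ * (1 / 2 + p.γ)) * ∑ i, (s.1 i : ℝ)
        ≤ (1 - p.γ * (1 / 2 + p.γ)) * ((1 + p.ζ) * (p.ε * m)) := by gcongr; exact hs.sum_le
      _ = ((1 - p.γ * (1 / 2 + p.γ)) * (1 + p.γ / 4)) * (p.ε * m) := by rw [ζ]; ring
      _ ≤ 1 * (p.ε * m) := by gcongr; nlinarith [pow_pos h0 2, pow_pos h0 3]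
      _ = p.ε * m := one_mul _
  · intro E hE hEε
    have h3 := potential_update_le (fun i => (s.1 i : ℝ)) (fun i => (N i : ℝ)) ℓ hpos h0 h2 hℓ01 hNi
      hadv E hE
    have h4 : potential (fun i => (s.1 i : ℝ)) E
        ≤ Real.log m + t * Real.log (1 - p.γ * (1 / 2 + p.γ))
        - Real.log (1 - p.γ) * ((∑ i ∈ E,
          (s.2.countP (fun h => decide (h (x i) = f (x i))) : ℝ)) / E.card)
        + p.ζ * Real.log p.cmax * (t / p.K : ℕ) := hs.potential_le E hE hEε
    have h5 : ∑ i ∈ E, ((h :: s.2).countP (fun h => decide (h (x i) = f (x i))) : ℝ)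
        = (∑ i ∈ E, (s.2.countP (fun h => decide (h (x i) = f (x i))) : ℝ)) + ∑ i ∈ E, ℓ i := by
      rw [← Finset.sum_add_distrib]
      refine Finset.sum_congr rfl fun i _ => ?_
      rw [List.countP_cons]
      simp only [hℓ]
      by_cases hi : h (x i) = f (x i) <;> simp [hi]
    rw [h5, add_div, mul_add (Real.log (1 - p.γ))]
    push_cast
    linarith

theorem invariant_succ_of_update (ht : (t + 1) % p.K ≠ 0) :
    p.Invariant H (fun i => labelled f (x i)) (t + 1)
      (p.update (fun i => labelled f (x i)) h s.1, h :: s.2) := by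
  obtain ⟨h1, h2, h3, h4, h5⟩ := p.update_properties hL hf x hs hh
  have hγ0 := p.hγ.1
  have hγ2 := p.hγ.2
  have hK := p.two_le_K
  have hεm : 0 ≤ p.ε * m := mul_nonneg p.hε.1.le (Nat.cast_nonneg m)
  have hmod : (t + 1) % p.K = t % p.K + 1 := by
    rw [Nat.add_mod, Nat.mod_eq_of_lt (show 1 < p.K by omega)] at ht ⊢
    have := Nat.mod_lt t (show 0 < p.K by omega)
    rcases Nat.lt_or_ge (t % p.K + 1) p.K with h | h
    · exact Nat.mod_eq_of_lt h
    · rw [show t % p.K + 1 = p.K by omega, Nat.mod_self] at ht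
      exact absurd rfl ht
  have hdiv : (t + 1) / p.K = t / p.K := by
    rw [Nat.succ_div, if_neg (fun h => ht (Nat.mod_eq_zero_of_dvd h)), add_zero]
  refine ⟨by simp [hs.length_eq], h1, fun i => (h2 i).trans (hs.le_one i), ?_, ?_, ?_⟩
  · refine h4.trans ?_
    nlinarith [p.ζ_pos]
  · refine hs.le_sum.trans (Finset.sum_le_sum fun i _ => min_le_min le_rfl ?_)
    rw [hmod, pow_succ, mul_inv, mul_assoc]
    have hg : 0 < 1 - p.γ := by linarith
    gcongr
    rw [le_inv_mul_iff₀ hg]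
    exact h3 i
  · intro E hE hEε
    rw [hdiv]
    exact h5 E hE hEε

theorem invariant_succ_of_project (ht : (t + 1) % p.K = 0) {M : PosMeasure m} {c : Set.Ici (1 : ℝ)}
    (hc : (c : ℝ) ≤ p.cmax) (hM : M = (p.update (fun i => labelled f (x i)) h s.1).scale c)
    (hlo : p.ε ≤ density (p.update (fun i => labelled f (x i)) h s.1) c)
    (hhi : density (p.update (fun i => labelled f (x i)) h s.1) c ≤ (1 + p.ζ) * p.ε) :
    p.Invariant H (fun i => labelled f (x i)) (t + 1) (M, h :: s.2) := by
  obtain ⟨h1, h2, h3, h4, h5⟩ := p.update_properties hL hf x hs hh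
  set N := p.update (fun i => labelled f (x i)) h s.1 with hN
  have hm : (0 : ℝ) < m := Nat.cast_pos.2 (Nat.pos_of_ne_zero (NeZero.ne m))
  have hc1 : (1 : ℝ) ≤ c := c.2
  have hMi : ∀ i, (M i : ℝ) = min 1 ((c : ℝ) * N i) := fun i => by rw [hM]; rfl
  have hM1 : ∀ i, (M i : ℝ) ≤ 1 := fun i => by rw [hMi]; exact min_le_left _ _
  have hsum : ∑ i, (M i : ℝ) = density N c * m := by
    rw [density, div_mul_cancel₀ _ hm.ne', Finset.sum_congr rfl fun i _ => hMi i]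
  have hlo' : p.ε * m ≤ ∑ i, (M i : ℝ) := by rw [hsum]; gcongr
  have hhi' : ∑ i, (M i : ℝ) ≤ (1 + p.ζ) * (p.ε * m) := by
    rw [hsum, ← mul_assoc]; gcongr
  have hdiv : (t + 1) / p.K = t / p.K + 1 := by
    rw [Nat.succ_div, if_pos (Nat.dvd_of_mod_eq_zero ht)]
  refine ⟨by simp [hs.length_eq], h1, hM1, hhi', ?_, ?_⟩
  · rw [ht, pow_zero, inv_one]
    simp only [one_mul]
    rw [Finset.sum_congr rfl fun i _ => min_eq_right (hM1 i)]
    exact hlo'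
  · intro E hE hEε
    have h6 := potential_scale_le (fun i => (M i : ℝ)) (fun i => (N i : ℝ)) (fun i => (N i).2)
      (fun i => (h2 i).trans (hs.le_one i)) hc1 hMi (mul_pos p.hε.1 hm) hlo' hhi' E hE hEε
    have h7 := h5 E hE hEε
    have h8 : p.ζ * Real.log c ≤ p.ζ * Real.log p.cmax :=
      mul_le_mul_of_nonneg_left (Real.log_le_log (by linarith) hc) p.ζ_pos.le
    rw [hdiv]
    change potential (fun i => (M i : ℝ)) E
        ≤ Real.log m + (t + 1 : ℕ) * Real.log (1 - p.γ * (1 / 2 + p.γ))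
        - Real.log (1 - p.γ) * ((∑ i ∈ E,
          ((h :: s.2).countP (fun h => decide (h (x i) = f (x i))) : ℝ)) / E.card)
        + p.ζ * Real.log p.cmax * (t / p.K + 1 : ℕ)
    push_cast at h7 ⊢
    linarith

theorem step_failure :
    (((if (t + 1) % p.K = 0 then p.project (p.update (fun i => labelled f (x i)) h s.1)
      else PMF.pure (p.update (fun i => labelled f (x i)) h s.1)).map
        fun M => (M, h :: s.2)).toOuterMeasure
      {s | p.Invariant H (fun i => labelled f (x i)) (t + 1) s}ᶜ)
      ≤ ENNReal.ofReal (p.δ / p.T) := by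
  obtain ⟨h1, h2, h3, h4, h5⟩ := p.update_properties hL hf x hs hh
  have hm : (0 : ℝ) < m := Nat.cast_pos.2 (Nat.pos_of_ne_zero (NeZero.ne m))
  rw [PMF.toOuterMeasure_map_apply]
  split_ifs with ht
  · set N := p.update (fun i => labelled f (x i)) h s.1 with hN
    have hγ0 := p.hγ.1
    have hγ2 := p.hγ.2
    have hg : 0 < 1 - p.γ := by linarith
    have hlo : density N 1 ≤ p.ε := by
      rw [density, div_le_iff₀ hm]
      exact (Finset.sum_le_sum fun i _ => (min_le_right _ _).trans (one_mul _).le).trans h4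
    have hhi : p.ε ≤ density N p.cmax := by
      rw [density, le_div_iff₀ hm]
      refine hs.le_sum.trans (Finset.sum_le_sum fun i _ => min_le_min le_rfl ?_)
      have hK := p.two_le_K
      have hmod : t % p.K + 1 = p.K := by
        have := Nat.mod_lt t (show 0 < p.K by omega)
        rw [Nat.add_mod, Nat.mod_eq_of_lt (show 1 < p.K by omega)] at ht
        rcases Nat.lt_or_ge (t % p.K + 1) p.K with h | h
        · rw [Nat.mod_eq_of_lt h] at ht
          omega
        · omega
      change _ ≤ ((1 - p.γ) ^ p.K)⁻¹ * (N i : ℝ)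
      rw [← hmod, pow_succ, mul_inv, mul_assoc, hmod]
      gcongr
      rw [le_inv_mul_iff₀ hg]
      exact h3 i
    refine le_trans (MeasureTheory.OuterMeasure.mono _ ?_) (p.project_failure N hlo hhi)
    rintro M hM ⟨c, hc1, hc2, hc3, hc4⟩
    exact hM (p.invariant_succ_of_project hL hf x hs hh ht hc1 hc2 hc3 hc4)
  · refine le_of_eq_of_le ?_ zero_le
    rw [PMF.toOuterMeasure_apply_eq_zero_iff, PMF.support_pure, Set.disjoint_singleton_left]
    exact fun hn => hn (p.invariant_succ_of_update hL hf x hs hh ht)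

end Step

theorem iterate_failure (p : Params) {X : Type*} {C : Set (X → Bool)} {H : Finset (X → Bool)}
    {L : Learner X} (hL : IsWeakLearner p.γ C H L) {f : X → Bool} (hf : f ∈ C) {m : ℕ} [NeZero m]
    (x : Fin m → X) (t : ℕ) :
    (p.iterate L (fun i => labelled f (x i)) t).toOuterMeasure
      {s | p.Invariant H (fun i => labelled f (x i)) t s}ᶜ ≤ t * ENNReal.ofReal (p.δ / p.T) := by
  induction t with
  | zero =>
    rw [iterate, Nat.cast_zero, zero_mul, nonpos_iff_eq_zero, PMF.toOuterMeasure_apply_eq_zero_iff,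
      PMF.support_pure, Set.disjoint_singleton_left]
    exact fun hn => hn (p.invariant_zero H _)
  | succ t ih =>
    rw [iterate, Nat.cast_succ, add_mul, one_mul]
    refine toOuterMeasure_bind_le _ _ _ _ ih fun s _ hs => ?_
    rw [← zero_add (ENNReal.ofReal _)]
    refine toOuterMeasure_bind_le _ _ Set.univ _ (by simp) fun h hh _ => ?_
    exact p.step_failure hL hf x hs hh

/-- If no projection fails, the majority vote errs on fewer than `ε m` examples. -/
theorem Invariant.card_error_lt {p : Params} {X : Type*} {H : Finset (X → Bool)} {m : ℕ} [NeZero m]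
    {S : Fin m → X × Bool} {s : PosMeasure m × List (X → Bool)} (hs : p.Invariant H S p.T s) :
    ((Finset.univ.filter fun i => majority s.2 (S i).1 ≠ (S i).2).card : ℝ) < p.ε * m := by
  set E := Finset.univ.filter fun i => majority s.2 (S i).1 ≠ (S i).2 with hEdef
  have hm : (0 : ℝ) < m := Nat.cast_pos.2 (Nat.pos_of_ne_zero (NeZero.ne m))
  have hε := p.hε.1
  have hγ0 := p.hγ.1
  have hγ2 := p.hγ.2
  by_contra hcon
  have hEε := not_lt.1 hcon
  have hn : (0 : ℝ) < E.card := lt_of_lt_of_le (by positivity) hEε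
  have hE : E.Nonempty := Finset.card_pos.1 (Nat.cast_pos.1 hn)
  have h1 := (log_card_le_potential _ (fun i => (s.1 i).2) E hE).trans (hs.potential_le E hE hEε)
  set Λ := -Real.log (1 - p.γ) with hΛ
  have hΛ0 : 0 ≤ Λ := by
    have := Real.log_nonpos (show 0 ≤ 1 - p.γ by linarith) (by linarith)
    linarith
  have h2 : (∑ i ∈ E, (s.2.countP (fun h => decide (h (S i).1 = (S i).2)) : ℝ)) / E.card
      ≤ p.T / 2 := by
    rw [div_le_iff₀ hn]
    calc (∑ i ∈ E, (s.2.countP (fun h => decide (h (S i).1 = (S i).2)) : ℝ))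
        ≤ ∑ i ∈ E, (p.T : ℝ) / 2 := by
          refine Finset.sum_le_sum fun i hi => ?_
          have h3 := two_mul_countP_le_of_majority_ne s.2 _ _ (Finset.mem_filter.1 hi).2
          rw [hs.length_eq] at h3
          have h4 : (2 : ℝ) * (s.2.countP (fun h => decide (h (S i).1 = (S i).2)) : ℝ) ≤ p.T := by
            exact_mod_cast h3
          linarith
      _ = p.T / 2 * E.card := by rw [Finset.sum_const, nsmul_eq_mul, mul_comm]
  have h3 : p.ζ * Real.log p.cmax * (p.T / p.K : ℕ) ≤ p.ζ * Λ * p.T := by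
    have h4 : ((p.K * (p.T / p.K) : ℕ) : ℝ) ≤ p.T := by
      exact_mod_cast Nat.mul_div_le p.T p.K
    rw [log_cmax, ← hΛ]
    calc p.ζ * (p.K * Λ) * (p.T / p.K : ℕ) = p.ζ * Λ * ((p.K * (p.T / p.K) : ℕ) : ℝ) := by
          push_cast; ring
      _ ≤ _ := by
          have := p.ζ_pos
          gcongr
  have h4 : Real.log m ≤ Real.log E.card + Real.log (1 / p.ε) := by
    rw [← Real.log_mul hn.ne' (by positivity)]
    refine Real.log_le_log hm ?_
    rw [mul_one_div, le_div_iff₀ hε]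
    linarith
  have h5 := gain_sub_loss hγ0 hγ2
  have h6 : 4 * Real.log (1 / p.ε) / p.γ ^ 2 < p.T := by
    have := Nat.lt_floor_add_one (4 * Real.log (1 / p.ε) / p.γ ^ 2)
    unfold T
    exact_mod_cast this
  rw [div_lt_iff₀ (by positivity)] at h6
  have h7 := mul_le_mul_of_nonneg_left h2 hΛ0
  have h8 := mul_le_mul_of_nonneg_left h5 (Nat.cast_nonneg (α := ℝ) p.T)
  have e : Real.log (1 - p.γ) = -Λ := by rw [hΛ, neg_neg]
  rw [e] at h1 h8
  unfold ζ at h1 h3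
  linarith

end Params

/-- Except with probability `δ`, QuantumBoost returns a majority vote of `T` members of `H` that
errs on fewer than `ε m` training examples. -/
theorem quantumBoost_failure (p : Params) {X : Type*} {C : Set (X → Bool)} {H : Finset (X → Bool)}
    {L : Learner X} (hL : IsWeakLearner p.γ C H L) {f : X → Bool} (hf : f ∈ C) {m : ℕ} [NeZero m]
    (x : Fin m → X) :
    (quantumBoost p L fun i => labelled f (x i)).toOuterMeasure
      {g | ∃ hs : List (X → Bool), g = majority hs ∧ hs.length = p.T ∧ (∀ h ∈ hs, h ∈ H) ∧
        ((Finset.univ.filter fun i => g (x i) ≠ f (x i)).card : ℝ) < p.ε * m}ᶜ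
      ≤ ENNReal.ofReal p.δ := by
  have hT : (0 : ℝ) < p.T := Nat.cast_pos.2 p.T_pos
  have hδ := p.hδ.1
  rw [quantumBoost, PMF.toOuterMeasure_map_apply]
  refine le_trans (MeasureTheory.OuterMeasure.mono _ ?_)
    ((p.iterate_failure hL hf x p.T).trans (le_of_eq ?_))
  · rintro s hs hinv
    exact hs ⟨s.2, rfl, hinv.length_eq, hinv.mem, hinv.card_error_lt⟩
  · rw [← ENNReal.ofReal_natCast, ← ENNReal.ofReal_mul (by positivity), mul_div_cancel₀ _ hT.ne']

/-! ### Growth functions -/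

theorem sum_choose_le_pow (n d : ℕ) : ∑ k ∈ Finset.Iic d, n.choose k ≤ (n + 1) ^ d := by
  rw [add_pow]
  have : Finset.Iic d = Finset.range (d + 1) := by ext; simp
  rw [this]
  refine Finset.sum_le_sum fun k hk => ?_
  have hk' : k ≤ d := Nat.lt_succ_iff.1 (Finset.mem_range.1 hk)
  calc n.choose k ≤ n ^ k * 1 ^ (d - k) * 1 := by simpa using Nat.choose_le_pow n k
    _ ≤ n ^ k * 1 ^ (d - k) * d.choose k := Nat.mul_le_mul_left _ (Nat.choose_pos hk')

/-- The Sauer–Shelah lemma for the labellings of a finite family of points, with repetitions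
allowed. -/
theorem card_image_comp_le {X ι : Type*} [Fintype X] [DecidableEq X] [Fintype ι] [DecidableEq ι]
    (H : Finset (X → Bool)) (u : ι → X) :
    (H.image fun h => h ∘ u).card ≤ (Fintype.card ι + 1) ^ vcDim H := by
  classical
  set A : Finset (Finset X) := H.image fun h => Finset.univ.filter fun x => h x = true with hA
  set B : Finset (Finset ι) := (H.image fun h => h ∘ u).image
    fun q => Finset.univ.filter fun i => q i = true with hB
  have hcard : (H.image fun h => h ∘ u).card = B.card := by
    refine (Finset.card_image_of_injective _ fun q q' hq => ?_).symm
    funext i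
    have : i ∈ (Finset.univ.filter fun i => q i = true) ↔
        i ∈ (Finset.univ.filter fun i => q' i = true) := by
      rw [show (Finset.univ.filter fun i => q i = true) = _ from hq]
    simpa using this
  have hsh : ∀ s, B.Shatters s → s.card ≤ vcDim H := by
    intro s hs
    have hmem : ∀ t ⊆ s, ∃ h ∈ H, ∀ i ∈ s, h (u i) = true ↔ i ∈ t := by
      intro t ht
      obtain ⟨b, hb, hbt⟩ := hs ht
      obtain ⟨q, hq, rfl⟩ := Finset.mem_image.1 hb
      obtain ⟨h, hh, rfl⟩ := Finset.mem_image.1 hq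
      refine ⟨h, hh, fun i hi => ?_⟩
      rw [← hbt]
      simp [hi]
    have hinj : Set.InjOn u s := by
      intro i hi j hj hij
      obtain ⟨h, _, hh⟩ := hmem {i} (Finset.singleton_subset_iff.2 hi)
      have h1 := (hh i hi).2 (Finset.mem_singleton_self i)
      rw [hij] at h1
      exact (Finset.mem_singleton.1 ((hh j hj).1 h1)).symm
    have hshA : A.Shatters (s.image u) := by
      intro t ht
      obtain ⟨h, hh, hhs⟩ := hmem (s.filter fun i => u i ∈ t) (Finset.filter_subset _ _)
      refine ⟨_, Finset.mem_image_of_mem _ hh, ?_⟩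
      ext y
      simp only [Finset.mem_inter, Finset.mem_image, Finset.mem_filter, Finset.mem_univ, true_and]
      constructor
      · rintro ⟨⟨i, hi, rfl⟩, hy⟩
        exact (Finset.mem_filter.1 ((hhs i hi).1 hy)).2
      · intro hy
        obtain ⟨i, hi, rfl⟩ := Finset.mem_image.1 (ht hy)
        exact ⟨⟨i, hi, rfl⟩, (hhs i hi).2 (Finset.mem_filter.2 ⟨hi, hy⟩)⟩
    have := hshA.card_le_vcDim
    rwa [Finset.card_image_of_injOn hinj] at this
  have hvc : B.vcDim ≤ vcDim H := Finset.sup_le fun s hs => hsh s (Finset.mem_shatterer.1 hs)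
  calc (H.image fun h => h ∘ u).card = B.card := hcard
    _ ≤ ∑ k ∈ Finset.Iic B.vcDim, (Fintype.card ι).choose k :=
        (Finset.card_le_card_shatterer B).trans Finset.card_shatterer_le_sum_vcDim
    _ ≤ (Fintype.card ι + 1) ^ B.vcDim := sum_choose_le_pow _ _
    _ ≤ (Fintype.card ι + 1) ^ vcDim H := Nat.pow_le_pow_right (Nat.succ_pos _) hvc

open Classical in
/-- The majority votes of `T` members of `H`. -/
def majorityClass {X : Type*} [Fintype X] (H : Finset (X → Bool)) (T : ℕ) : Finset (X → Bool) :=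
  Finset.univ.filter fun g => ∃ hs : List (X → Bool), g = majority hs ∧ hs.length = T ∧
    ∀ h ∈ hs, h ∈ H

theorem mem_majorityClass {X : Type*} [Fintype X] {H : Finset (X → Bool)} {T : ℕ} {g : X → Bool} :
    g ∈ majorityClass H T ↔
      ∃ hs : List (X → Bool), g = majority hs ∧ hs.length = T ∧ ∀ h ∈ hs, h ∈ H := by
  simp [majorityClass]

theorem majority_comp {X ι : Type*} (hs : List (X → Bool)) (u : ι → X) :
    majority hs ∘ u = majority (hs.map fun h => h ∘ u) := by
  funext i
  simp only [majority, Function.comp_apply, List.length_map, List.countP_map]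
  rfl

theorem card_image_majorityClass_le {X ι : Type*} [Fintype X] [DecidableEq X] [Fintype ι]
    [DecidableEq ι] (H : Finset (X → Bool)) (T : ℕ) (u : ι → X) :
    ((majorityClass H T).image fun g => g ∘ u).card
      ≤ (Fintype.card ι + 1) ^ (vcDim H * T) := by
  classical
  have hsub : ((majorityClass H T).image fun g => g ∘ u) ⊆
      (Fintype.piFinset fun _ : Fin T => H.image fun h => h ∘ u).image
        fun q => majority (List.ofFn q) := by
    intro q hq
    obtain ⟨g, hg, rfl⟩ := Finset.mem_image.1 hq
    obtain ⟨hs, rfl, rfl, hH⟩ := mem_majorityClass.1 hg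
    refine Finset.mem_image.2 ⟨fun k => hs.get k ∘ u, ?_, ?_⟩
    · exact Fintype.mem_piFinset.2 fun k =>
        Finset.mem_image.2 ⟨hs.get k, hH _ (List.get_mem hs k), rfl⟩
    · rw [majority_comp]
      congr 1
      refine List.ext_get (by simp) fun n h1 h2 => ?_
      simp
  calc _ ≤ _ := Finset.card_le_card hsub
    _ ≤ (Fintype.piFinset fun _ : Fin T => H.image fun h => h ∘ u).card := Finset.card_image_le
    _ = (H.image fun h => h ∘ u).card ^ T := by rw [Fintype.card_piFinset_const]
    _ ≤ ((Fintype.card ι + 1) ^ vcDim H) ^ T := Nat.pow_le_pow_left (card_image_comp_le H u) T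
    _ = _ := (pow_mul _ _ _).symm

/-! ### A relative deviation bound -/

/-- The factor `exp (λ (3 b / 4 - a))`, with `λ = 1 / 10`, that a pair contributes when the
indicators of an error on its two members are `a` and `b`. As `3 / 4 < 1`, the average of this factor
over the two orders of the pair is at most `1` for small `λ`. -/
def pairWeight (a : Bool × Bool) : ℝ :=
  Real.exp ((if a.2 then 3 / 40 else 0) - (if a.1 then 1 / 10 else 0))

theorem pairWeight_add_swap_le (a : Bool × Bool) : pairWeight a + pairWeight a.swap ≤ 2 := by
  have h1 := abs_le.1 (Real.abs_exp_sub_one_sub_id_le (show |(3 / 40 : ℝ)| ≤ 1 by norm_num [abs_le]))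
  have h2 := abs_le.1 (Real.abs_exp_sub_one_sub_id_le (show |(-(1 / 10) : ℝ)| ≤ 1 by norm_num [abs_le]))
  have h3 : Real.exp (-(1 / 40)) ≤ 1 := Real.exp_le_one_iff.2 (by norm_num)
  rcases a with ⟨a, b⟩
  cases a <;> cases b <;> simp only [pairWeight, Prod.swap, if_true, Bool.false_eq_true, if_false,
    sub_zero, zero_sub, Real.exp_zero] <;> norm_num at h1 h2 ⊢ <;> linarith

section Symmetrization

variable {X : Type*}

/-- The joint error patterns of the members of `G` on pairs of points. -/
def patterns {m : ℕ} (G : Finset (X → Bool)) (z : Fin m → X × X) : Finset (Fin m → Bool × Bool) :=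
  G.image fun g i => (g (z i).1, g (z i).2)

/-- Exchanging the two members of the pairs selected by `σ`. -/
def swapPairs {m : ℕ} {α : Type*} (σ : Fin m → Bool) (z : Fin m → α × α) : Fin m → α × α :=
  fun i => if σ i then (z i).swap else z i

theorem swapPairs_swapPairs {m : ℕ} {α : Type*} (σ : Fin m → Bool) (z : Fin m → α × α) :
    swapPairs σ (swapPairs σ z) = z := by
  funext i
  simp only [swapPairs]
  split_ifs <;> simp

theorem patterns_swapPairs {m : ℕ} (G : Finset (X → Bool)) (σ : Fin m → Bool) (z : Fin m → X × X) :
    patterns G (swapPairs σ z) = (patterns G z).image (swapPairs σ) := by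
  rw [patterns, patterns, Finset.image_image]
  refine Finset.image_congr fun g _ => ?_
  funext i
  simp only [Function.comp_apply, swapPairs]
  split_ifs <;> rfl

/-- Averaging over all exchanges of the members of the pairs, each pattern contributes at most
`1`. -/
theorem sum_patterns_le [Fintype X] {m : ℕ} (w : X → ℝ) (hw : ∀ a, 0 ≤ w a) (hw1 : ∑ a, w a = 1)
    (G : Finset (X → Bool)) (N : ℕ) (hN : ∀ z : Fin m → X × X, (patterns G z).card ≤ N) :
    ∑ z : Fin m → X × X, (∏ i, w (z i).1 * w (z i).2) * ∑ q ∈ patterns G z, ∏ i, pairWeight (q i)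
      ≤ N := by
  classical
  set W : (Fin m → X × X) → ℝ := fun z => ∏ i, w (z i).1 * w (z i).2 with hW
  have hW0 : ∀ z, 0 ≤ W z := fun z => Finset.prod_nonneg fun i _ => mul_nonneg (hw _) (hw _)
  have hW1 : ∑ z, W z = 1 := by
    have h := Finset.prod_univ_sum (fun _ : Fin m => (Finset.univ : Finset (X × X)))
      (fun _ a => w a.1 * w a.2)
    rw [Fintype.piFinset_univ] at h
    rw [← h, Finset.prod_eq_one fun i _ => ?_]
    rw [Fintype.sum_prod_type]
    simp only [← Finset.mul_sum, hw1, mul_one]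
  have hswap : ∀ σ : Fin m → Bool,
      ∑ z, W z * ∑ q ∈ patterns G z, ∏ i, pairWeight (q i)
        = ∑ z, W z * ∑ q ∈ patterns G z, ∏ i, pairWeight (swapPairs σ q i) := by
    intro σ
    refine Finset.sum_nbij' (swapPairs σ) (swapPairs σ) (fun _ _ => Finset.mem_univ _)
      (fun _ _ => Finset.mem_univ _) (fun z _ => swapPairs_swapPairs σ z)
      (fun z _ => swapPairs_swapPairs σ z) fun z _ => ?_
    congr 1
    · refine Finset.prod_congr rfl fun i _ => ?_
      simp only [swapPairs]
      split_ifs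
      · exact mul_comm _ _
      · rfl
    · rw [patterns_swapPairs, Finset.sum_image]
      · simp only [swapPairs_swapPairs]
      · intro q _ q' _ h
        rw [← swapPairs_swapPairs σ q, h, swapPairs_swapPairs]
  have hbound : ∀ q : Fin m → Bool × Bool,
      ∑ σ : Fin m → Bool, ∏ i, pairWeight (swapPairs σ q i) ≤ 2 ^ m := by
    intro q
    have h := Finset.prod_univ_sum (fun _ : Fin m => (Finset.univ : Finset Bool))
      (fun i b => pairWeight (if b then (q i).swap else q i))
    rw [Fintype.piFinset_univ] at h
    simp only [swapPairs]
    rw [← h]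
    calc ∏ i, ∑ b : Bool, pairWeight (if b then (q i).swap else q i) ≤ ∏ i : Fin m, (2 : ℝ) := by
          refine Finset.prod_le_prod (fun i _ => Finset.sum_nonneg fun b _ => (Real.exp_pos _).le)
            fun i _ => ?_
          rw [Fintype.sum_bool]
          simpa [add_comm] using pairWeight_add_swap_le (q i)
      _ = 2 ^ m := by simp
  have htotal : (2 : ℝ) ^ m * ∑ z, W z * ∑ q ∈ patterns G z, ∏ i, pairWeight (q i)
      ≤ 2 ^ m * N := by
    calc (2 : ℝ) ^ m * ∑ z, W z * ∑ q ∈ patterns G z, ∏ i, pairWeight (q i)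
        = ∑ σ : Fin m → Bool, ∑ z, W z * ∑ q ∈ patterns G z, ∏ i, pairWeight (swapPairs σ q i) := by
          rw [← Finset.sum_congr rfl fun σ _ => hswap σ]
          simp
      _ = ∑ z, W z * ∑ q ∈ patterns G z, ∑ σ : Fin m → Bool, ∏ i, pairWeight (swapPairs σ q i) := by
          rw [Finset.sum_comm]
          refine Finset.sum_congr rfl fun z _ => ?_
          rw [← Finset.mul_sum, Finset.sum_comm]
      _ ≤ ∑ z, W z * (2 ^ m * N) := by
          refine Finset.sum_le_sum fun z _ => mul_le_mul_of_nonneg_left ?_ (hW0 z)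
          calc _ ≤ ∑ q ∈ patterns G z, (2 : ℝ) ^ m := Finset.sum_le_sum fun q _ => hbound q
            _ = 2 ^ m * (patterns G z).card := by rw [Finset.sum_const, nsmul_eq_mul, mul_comm]
            _ ≤ _ := by
              have : ((patterns G z).card : ℝ) ≤ N := by exact_mod_cast hN z
              gcongr
      _ = 2 ^ m * N := by rw [← Finset.sum_mul, hW1, one_mul]
  exact le_of_mul_le_mul_left htotal (by positivity)

/-- If the members of `G` have at most `N` joint patterns on two samples of size `m`, then, except
with probability `N exp (-ε m / 40)`, a sample of size `m` meets every `g ∈ G` of probability more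
than `ε` in more than `ε m / 2` points. The exponential moment of the deviation is compared, by
Jensen's inequality, with that for an independent second sample. -/
theorem relative_deviation [Fintype X] (D : PMF X) (m : ℕ) (G : Finset (X → Bool)) (N : ℕ)
    (hN : ∀ z : Fin m → X × X, (patterns G z).card ≤ N) (ε : ℝ) :
    (iid D m).toOuterMeasure {x | ∃ g ∈ G, ε < (D.toOuterMeasure {a | g a = true}).toReal ∧
      ((Finset.univ.filter fun i => g (x i) = true).card : ℝ) ≤ ε * m / 2}
      ≤ ENNReal.ofReal (N * Real.exp (-(ε * m / 40))) := by
  classical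
  set bad : Set (Fin m → X) := {x | ∃ g ∈ G, ε < (D.toOuterMeasure {a | g a = true}).toReal ∧
      ((Finset.univ.filter fun i => g (x i) = true).card : ℝ) ≤ ε * m / 2} with hbad
  set w : X → ℝ := fun a => (D a).toReal with hw
  have hw0 : ∀ a, 0 ≤ w a := fun a => ENNReal.toReal_nonneg
  have hw1 : ∑ a, w a = 1 := by
    rw [← ENNReal.toReal_sum fun a _ => D.apply_ne_top a, ← tsum_fintype (L := .unconditional _),
      D.tsum_coe, ENNReal.toReal_one]
  have hiid : ∀ x, (iid D m x).toReal = ∏ i, w (x i) := fun x => by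
    rw [iid_apply, ENNReal.toReal_prod]
  have hiid0 : ∀ x : Fin m → X, 0 ≤ ∏ i, w (x i) := fun x => Finset.prod_nonneg fun i _ => hw0 _
  set Φ : (Fin m → X × X) → ℝ := fun z => ∑ q ∈ patterns G z, ∏ i, pairWeight (q i) with hΦ
  have hkey : ∀ x ∈ bad, Real.exp (ε * m / 40)
      ≤ ∑ x' : Fin m → X, (∏ i, w (x' i)) * Φ fun i => (x i, x' i) := by
    rintro x ⟨g, hg, hgε, hgx⟩
    set μ := (D.toOuterMeasure {a | g a = true}).toReal with hμ
    have hμ' : μ = ∑ a, w a * (if g a then 1 else 0) := by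
      rw [hμ, toReal_toOuterMeasure]
      refine Finset.sum_congr rfl fun a _ => ?_
      by_cases h : g a = true <;> simp [h, hw]
    have hjensen : Real.exp (3 / 40 * μ) ≤ ∑ a, w a * Real.exp (if g a then 3 / 40 else 0) := by
      have h := convexOn_exp.map_sum_le (t := Finset.univ) (w := w)
        (p := fun a => if g a then (3 / 40 : ℝ) else 0) (fun a _ => hw0 a) hw1
        (fun _ _ => Set.mem_univ _)
      simp only [smul_eq_mul] at h
      refine le_trans (le_of_eq ?_) h
      rw [hμ', Finset.mul_sum]
      congr 1
      refine Finset.sum_congr rfl fun a _ => ?_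
      split_ifs <;> ring
    have hcount : ∏ i, Real.exp (-(if g (x i) then 1 / 10 else 0))
        = Real.exp (-(1 / 10 * ((Finset.univ.filter fun i => g (x i) = true).card : ℝ))) := by
      rw [← Real.exp_sum, Finset.sum_neg_distrib]
      congr 2
      rw [← Finset.sum_filter, Finset.sum_const, nsmul_eq_mul, mul_comm]
    have hprod : (∑ a, w a * Real.exp (if g a then 3 / 40 else 0)) ^ m
        = ∑ x' : Fin m → X, ∏ i, w (x' i) * Real.exp (if g (x' i) then 3 / 40 else 0) := by
      have h := Finset.prod_univ_sum (fun _ : Fin m => (Finset.univ : Finset X))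
        (fun _ a => w a * Real.exp (if g a then 3 / 40 else 0))
      rw [Fintype.piFinset_univ] at h
      rw [← h]
      simp
    calc Real.exp (ε * m / 40)
        ≤ Real.exp (m * (3 / 40 * μ)
          + -(1 / 10 * ((Finset.univ.filter fun i => g (x i) = true).card : ℝ))) := by
          refine Real.exp_le_exp.2 ?_
          have : (m : ℝ) * ε ≤ m * μ := by gcongr
          linarith
      _ = Real.exp (3 / 40 * μ) ^ m * ∏ i, Real.exp (-(if g (x i) then 1 / 10 else 0)) := by
          rw [Real.exp_add, Real.exp_nat_mul, hcount]
      _ ≤ (∑ a, w a * Real.exp (if g a then 3 / 40 else 0)) ^ m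
          * ∏ i, Real.exp (-(if g (x i) then 1 / 10 else 0)) := by gcongr
      _ = ∑ x' : Fin m → X, (∏ i, w (x' i)) * ∏ i, pairWeight (g (x i), g (x' i)) := by
          rw [hprod, Finset.sum_mul]
          refine Finset.sum_congr rfl fun x' _ => ?_
          rw [← Finset.prod_mul_distrib, ← Finset.prod_mul_distrib]
          refine Finset.prod_congr rfl fun i _ => ?_
          rw [mul_assoc, ← Real.exp_add, pairWeight, sub_eq_add_neg]
      _ ≤ _ := by
          refine Finset.sum_le_sum fun x' _ => mul_le_mul_of_nonneg_left ?_ (hiid0 x')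
          exact Finset.single_le_sum (f := fun q : Fin m → Bool × Bool => ∏ i, pairWeight (q i))
            (fun q _ => Finset.prod_nonneg fun i _ => (Real.exp_pos _).le)
            (Finset.mem_image.2 ⟨g, hg, rfl⟩)
  have hΦ0 : ∀ z, 0 ≤ Φ z := fun z =>
    Finset.sum_nonneg fun q _ => Finset.prod_nonneg fun i _ => (Real.exp_pos _).le
  have hmain : ((iid D m).toOuterMeasure bad).toReal * Real.exp (ε * m / 40) ≤ N := by
    rw [toReal_toOuterMeasure, Finset.sum_mul]
    calc ∑ x, (if x ∈ bad then (iid D m x).toReal else 0) * Real.exp (ε * m / 40)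
        ≤ ∑ x : Fin m → X, (∏ i, w (x i))
            * ∑ x' : Fin m → X, (∏ i, w (x' i)) * Φ fun i => (x i, x' i) := by
          refine Finset.sum_le_sum fun x _ => ?_
          split_ifs with hx
          · rw [hiid]
            exact mul_le_mul_of_nonneg_left (hkey x hx) (hiid0 x)
          · rw [zero_mul]
            exact mul_nonneg (hiid0 x) (Finset.sum_nonneg fun x' _ => mul_nonneg (hiid0 x') (hΦ0 _))
      _ = ∑ z : Fin m → X × X, (∏ i, w (z i).1 * w (z i).2) * Φ z := by
          rw [← (Equiv.arrowProdEquivProdArrow (Fin m) (fun _ => X) (fun _ => X)).symm.sum_comp,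
            Fintype.sum_prod_type]
          refine Finset.sum_congr rfl fun x _ => ?_
          rw [Finset.mul_sum]
          refine Finset.sum_congr rfl fun x' _ => ?_
          rw [← mul_assoc, ← Finset.prod_mul_distrib]
          rfl
      _ ≤ N := sum_patterns_le w hw0 hw1 G N hN
  have hne : (iid D m).toOuterMeasure bad ≠ ⊤ := by
    refine ne_top_of_le_ne_top ENNReal.one_ne_top ?_
    rw [← (PMF.toOuterMeasure_apply_eq_one_iff (iid D m) Set.univ).2 (Set.subset_univ _)]
    exact (iid D m).toOuterMeasure.mono (Set.subset_univ bad)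
  rw [← ENNReal.ofReal_toReal hne]
  refine ENNReal.ofReal_le_ofReal ?_
  rw [Real.exp_neg, ← div_eq_mul_inv, le_div_iff₀ (Real.exp_pos _)]
  exact hmain

end Symmetrization

/-! ### Classes of VC-dimension at most one -/

theorem one_le_vcDim {X : Type*} [Fintype X] [DecidableEq X] {H : Finset (X → Bool)} {h h' : X → Bool}
    (hh : h ∈ H) (hh' : h' ∈ H) (hne : h ≠ h') : 1 ≤ vcDim H := by
  classical
  obtain ⟨a, ha⟩ := Function.ne_iff.1 hne
  have hall : ∀ b : Bool, ∃ k ∈ H, k a = b := by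
    intro b
    by_cases hb : h a = b
    · exact ⟨h, hh, hb⟩
    · refine ⟨h', hh', ?_⟩
      revert ha hb
      cases h a <;> cases h' a <;> cases b <;> simp
  have hsh : (H.image fun h => Finset.univ.filter fun x => h x = true).Shatters {a} := by
    intro t ht
    obtain ⟨k, hk, hka⟩ := hall (decide (a ∈ t))
    refine ⟨_, Finset.mem_image_of_mem _ hk, ?_⟩
    ext y
    simp only [Finset.mem_inter, Finset.mem_singleton, Finset.mem_filter, Finset.mem_univ, true_and]
    constructor
    · rintro ⟨rfl, hy⟩
      simpa [hka] using hy
    · intro hy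
      obtain rfl := Finset.mem_singleton.1 (ht hy)
      exact ⟨rfl, by simpa [hka] using hy⟩
  exact hsh.card_le_vcDim

/-- A class of VC-dimension at most one misses a labelling of every pair of points. -/
theorem exists_missing_pattern {X : Type*} [Fintype X] [DecidableEq X] {H : Finset (X → Bool)}
    (hd : vcDim H ≤ 1) {a b : X} (hab : a ≠ b) :
    ∃ p q : Bool, ∀ h ∈ H, h a = p → h b ≠ q := by
  classical
  by_contra hcon
  push Not at hcon
  have hsh : (H.image fun h => Finset.univ.filter fun x => h x = true).Shatters {a, b} := by
    intro t ht
    obtain ⟨k, hk, hka, hkb⟩ := hcon (decide (a ∈ t)) (decide (b ∈ t))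
    refine ⟨_, Finset.mem_image_of_mem _ hk, ?_⟩
    ext y
    simp only [Finset.mem_inter, Finset.mem_insert, Finset.mem_singleton, Finset.mem_filter,
      Finset.mem_univ, true_and]
    constructor
    · rintro ⟨rfl | rfl, hy⟩
      · simpa [hka] using hy
      · simpa [hkb] using hy
    · intro hy
      rcases Finset.mem_insert.1 (ht hy) with rfl | hy'
      · exact ⟨Or.inl rfl, by simpa [hka] using hy⟩
      · obtain rfl := Finset.mem_singleton.1 hy'
        exact ⟨Or.inr rfl, by simpa [hkb] using hy⟩
  have := hsh.card_le_vcDim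
  rw [Finset.card_pair hab] at this
  exact absurd (this.trans hd) (by norm_num)

theorem majority_ne_of_forall {X : Type*} (hs : List (X → Bool)) (a b : X) (y : Bool)
    (h : ∀ g ∈ hs, g a ≠ y → g b ≠ y) (ha : majority hs a ≠ y) : majority hs b ≠ y := by
  cases y with
  | true =>
    simp only [majority, ne_eq, decide_eq_true_eq, not_lt] at ha ⊢
    have : hs.countP (fun g => g b) ≤ hs.countP fun g => g a :=
      List.countP_mono_left fun g hg hb => by
        by_contra hga
        exact h g hg hga hb
    omega
  | false =>
    simp only [majority, ne_eq, Bool.not_eq_false, decide_eq_true_eq] at ha ⊢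
    have : hs.countP (fun g => g a) ≤ hs.countP fun g => g b :=
      List.countP_mono_left fun g hg hga => by
        have := h g hg (by simp [hga])
        simpa using this
    omega

/-- A majority vote cannot be wrong at three points at each pair of which every member of the list
is right at least once. -/
theorem not_three_majority_ne {X : Type*} (hs : List (X → Bool)) (hne : 0 < hs.length) (a b c : X)
    (y : Bool) (h : ∀ g ∈ hs, (g a = y ∨ g b = y) ∧ (g a = y ∨ g c = y) ∧ (g b = y ∨ g c = y))
    (ha : majority hs a ≠ y) (hb : majority hs b ≠ y) (hc : majority hs c ≠ y) : False := by
  have h1 := two_mul_countP_le_of_majority_ne hs a y ha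
  have h2 := two_mul_countP_le_of_majority_ne hs b y hb
  have h3 := two_mul_countP_le_of_majority_ne hs c y hc
  have key : ∀ l : List (X → Bool),
      (∀ g ∈ l, (g a = y ∨ g b = y) ∧ (g a = y ∨ g c = y) ∧ (g b = y ∨ g c = y)) →
      2 * l.length ≤ l.countP (fun h => decide (h a = y)) + l.countP (fun h => decide (h b = y))
        + l.countP (fun h => decide (h c = y)) := by
    intro l hl
    induction l with
    | nil => simp
    | cons g l ih =>
      have ih' := ih fun k hk => hl k (List.mem_cons_of_mem _ hk)
      have hg := hl g List.mem_cons_self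
      simp only [List.countP_cons, List.length_cons, decide_eq_true_eq]
      by_cases e1 : g a = y <;> by_cases e2 : g b = y <;> by_cases e3 : g c = y <;>
        simp [e1, e2, e3] at hg ⊢ <;> omega
  have h4 := key hs h
  omega

section VCDimOne

variable {X : Type*} [Fintype X] [DecidableEq X] {γ : ℝ} {C : Set (X → Bool)}
  {H : Finset (X → Bool)} {L : Learner X} {f : X → Bool}

/-- Some member of `H` is right on more than half of any `k` given points. -/
theorem IsWeakLearner.exists_half_lt {Y : Type*} {γ : ℝ} {C : Set (Y → Bool)}
    {H : Finset (Y → Bool)} {L : Learner Y} {f : Y → Bool} (hγ : 0 < γ)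
    (hL : IsWeakLearner γ C H L) (hf : f ∈ C) {k : ℕ} [NeZero k] (y : Fin k → Y) :
    ∃ h ∈ H, k < 2 * (Finset.univ.filter fun i => h (y i) = f (y i)).card := by
  set M : PosMeasure k := fun _ => ⟨1, one_pos (α := ℝ)⟩
  obtain ⟨h, hh⟩ := (L (M.dist.map fun i => labelled f (y i))).support_nonempty
  obtain ⟨h1, h2⟩ := hL.advantage hf M y hh
  refine ⟨h, h1, ?_⟩
  have hk : (0 : ℝ) < k := Nat.cast_pos.2 (Nat.pos_of_ne_zero (NeZero.ne k))
  simp only [M, one_mul, Finset.sum_boole, Finset.sum_const, Finset.card_univ, Fintype.card_fin,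
    nsmul_eq_mul, mul_one] at h2
  have : (k : ℝ) < 2 * ((Finset.univ.filter fun i => h (y i) = f (y i)).card : ℝ) := by nlinarith
  exact_mod_cast this

/-- If `H` has VC-dimension at most one and admits a weak learner, then there are no `14` points
each of which is the only one that some majority vote of members of `H` classifies correctly.
Among `14` points there are four with the same label on which a single member of `H` is right, so
that on each pair of them `H` realizes "right, right" and misses one of the other three patterns.
If it misses "wrong, right" in one of the two orders, the votes err on one of the two points
whenever they err on the other. So it always misses "wrong, wrong", and then three of the four
points cannot be misclassified by one vote. -/
theorem not_fourteen_separated (hγ : 0 < γ) (hL : IsWeakLearner γ C H L) (hf : f ∈ C)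
    (hd : vcDim H ≤ 1) {T : ℕ} (hT : 0 < T) (y : Fin 14 → X) (g : Fin 14 → X → Bool)
    (hg : ∀ i, g i ∈ majorityClass H T) (hgi : ∀ i, g i (y i) = f (y i))
    (hgj : ∀ i j, i ≠ j → g i (y j) ≠ f (y j)) : False := by
  classical
  obtain ⟨h₀, hh₀, hcard⟩ := hL.exists_half_lt hγ hf y
  set A := Finset.univ.filter fun i => h₀ (y i) = f (y i) with hA
  -- four points with the same label on which `h₀` is right
  have hJ : ∃ (b : Bool) (J : Finset (Fin 14)), J.card = 4 ∧ ∀ i ∈ J, h₀ (y i) = b ∧ f (y i) = b := by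
    have hsplit := Finset.card_filter_add_card_filter_not (s := A) (fun i => f (y i) = true)
    have : 4 ≤ (A.filter fun i => f (y i) = true).card ∨
        4 ≤ (A.filter fun i => ¬ f (y i) = true).card := by omega
    rcases this with h | h
    · obtain ⟨J, hJ, hJc⟩ := Finset.exists_subset_card_eq h
      refine ⟨true, J, hJc, fun i hi => ?_⟩
      obtain ⟨h1, h2⟩ := Finset.mem_filter.1 (hJ hi)
      exact ⟨(Finset.mem_filter.1 h1).2.trans h2, h2⟩
    · obtain ⟨J, hJ, hJc⟩ := Finset.exists_subset_card_eq h
      refine ⟨false, J, hJc, fun i hi => ?_⟩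
      obtain ⟨h1, h2⟩ := Finset.mem_filter.1 (hJ hi)
      have h2' : f (y i) = false := by simpa using h2
      exact ⟨(Finset.mem_filter.1 h1).2.trans h2', h2'⟩
  obtain ⟨b, J, hJc, hJ⟩ := hJ
  have hdisj : ∀ i ∈ J, ∀ j ∈ J, i ≠ j → ∀ h ∈ H, h (y i) = b ∨ h (y j) = b := by
    intro i hi j hj hij h hh
    have hyij : y i ≠ y j := by
      intro he
      have := hgj i j hij
      rw [← he] at this
      exact this (hgi i)
    obtain ⟨p, q, hpq⟩ := exists_missing_pattern hd hyij
    have hcmp : ∀ i ∈ J, ∀ j ∈ J, i ≠ j → ¬ ∀ h ∈ H, h (y i) ≠ b → h (y j) ≠ b := by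
      intro i hi j hj hij hall
      obtain ⟨hs, hgs, _, hmem⟩ := mem_majorityClass.1 (hg j)
      have h1 := hgj j i hij.symm
      rw [(hJ i hi).2, hgs] at h1
      have h2 := majority_ne_of_forall hs (y i) (y j) b (fun k hk => hall k (hmem k hk)) h1
      rw [← hgs, hgi, (hJ j hj).2] at h2
      exact h2 rfl
    have hb : ∀ c : Bool, c = b ∨ c = !b := by
      intro c
      cases b <;> cases c <;> simp
    rcases hb p with rfl | rfl <;> rcases hb q with rfl | rfl
    · exact absurd (hJ j hj).1 (hpq h₀ hh₀ (hJ i hi).1)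
    · refine absurd (fun k hk hkj hki => hpq k hk hki ?_) (hcmp j hj i hi hij.symm)
      exact (hb (k (y j))).resolve_left hkj
    · refine absurd (fun k hk hki hkj => hpq k hk ?_ hkj) (hcmp i hi j hj hij)
      exact (hb (k (y i))).resolve_left hki
    · rcases hb (h (y i)) with h1 | h1
      · exact Or.inl h1
      · rcases hb (h (y j)) with h2 | h2
        · exact Or.inr h2
        · exact absurd h2 (hpq h hh h1)
  obtain ⟨i₁, J', hi₁, rfl, hJ'c⟩ := Finset.card_eq_succ.1 hJc
  obtain ⟨i₂, i₃, i₄, h23, h24, h34, rfl⟩ := Finset.card_eq_three.1 hJ'c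
  simp only [Finset.mem_insert, Finset.mem_singleton, not_or] at hi₁
  obtain ⟨h12, h13, h14⟩ := hi₁
  obtain ⟨hs, hgs, hlen, hmem⟩ := mem_majorityClass.1 (hg i₁)
  have hwrong : ∀ j ∈ insert i₁ ({i₂, i₃, i₄} : Finset (Fin 14)), i₁ ≠ j → majority hs (y j) ≠ b := by
    intro j hj hne
    rw [← hgs, ← (hJ j hj).2]
    exact hgj i₁ j hne
  refine not_three_majority_ne hs (by omega) (y i₂) (y i₃) (y i₄) b (fun k hk => ⟨?_, ?_, ?_⟩)
    (hwrong i₂ (by simp) h12) (hwrong i₃ (by simp) h13) (hwrong i₄ (by simp) h14)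
  · exact hdisj i₂ (by simp) i₃ (by simp) h23 k (hmem k hk)
  · exact hdisj i₂ (by simp) i₄ (by simp) h24 k (hmem k hk)
  · exact hdisj i₃ (by simp) i₄ (by simp) h34 k (hmem k hk)

theorem iid_toOuterMeasure_pair {α : Type*} [Fintype α] (D : PMF α) (k : ℕ) {i j : Fin k}
    (hij : i ≠ j) (u : α) (B : Set α) :
    (iid D k).toOuterMeasure {v | v i = u ∧ v j ∈ B} = D u * D.toOuterMeasure B := by
  classical
  have h := iid_toOuterMeasure_pi D k fun l => if l = i then {u} else if l = j then B else Set.univ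
  have h2 : {v : Fin k → α | ∀ l, v l ∈ (if l = i then {u} else if l = j then B else Set.univ)}
      = {v | v i = u ∧ v j ∈ B} := by
    ext v
    rw [Set.mem_ofPred_eq, Set.mem_ofPred_eq]
    constructor
    · intro hv
      have h1 := hv i
      have h2 := hv j
      simp only [if_true, hij.symm, if_false] at h1 h2
      exact ⟨h1, h2⟩
    · rintro ⟨h1, h2⟩ l
      by_cases hl : l = i
      · subst hl; simpa using h1
      · by_cases hl' : l = j
        · subst hl'; simpa [hl] using h2
        · simp [hl, hl']
  rw [h2] at h
  rw [h, Finset.prod_eq_mul i j hij]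
  · simp [hij.symm]
  · intro l _ hl
    simp only [hl.1, hl.2, if_false]
    exact (PMF.toOuterMeasure_apply_eq_one_iff _ _).2 (Set.subset_univ _)
  · intro h; exact absurd (Finset.mem_univ i) h
  · intro h; exact absurd (Finset.mem_univ j) h

theorem toOuterMeasure_le_of_lt_err {X : Type*} (D : PMF X) (f g : X → Bool) {η : ℝ}
    (hg : 1 - η < err D f g) : D.toOuterMeasure {a | g a = f a} ≤ ENNReal.ofReal η := by
  have h1 : D.toOuterMeasure {a | g a = f a} + D.toOuterMeasure {a | g a ≠ f a} = 1 := by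
    rw [PMF.toOuterMeasure_apply, PMF.toOuterMeasure_apply, ← ENNReal.tsum_add, ← D.tsum_coe]
    refine tsum_congr fun a => ?_
    by_cases h : g a = f a <;> simp [h]
  have h2 : D.toOuterMeasure {a | g a = f a} ≠ ⊤ :=
    ne_top_of_le_ne_top ENNReal.one_ne_top (h1 ▸ le_self_add)
  have h3 : D.toOuterMeasure {a | g a ≠ f a} ≠ ⊤ :=
    ne_top_of_le_ne_top ENNReal.one_ne_top (h1 ▸ le_add_self)
  have h4 := congrArg ENNReal.toReal h1
  rw [ENNReal.toReal_add h2 h3, ENNReal.toReal_one] at h4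
  unfold err at hg
  rw [← ENNReal.ofReal_toReal h2]
  exact ENNReal.ofReal_le_ofReal (by linarith)

/-- For VC-dimension at most one, few points are classified correctly by a majority vote of error
more than `1 - η`. -/
theorem pow_fourteen_le (hγ : 0 < γ) (hL : IsWeakLearner γ C H L) (hf : f ∈ C)
    (hd : vcDim H ≤ 1) {T : ℕ} (hT : 0 < T) (D : PMF X) (η : ℝ) :
    D.toOuterMeasure {a | ∃ g ∈ majorityClass H T, 1 - η < err D f g ∧ g a = f a} ^ 14
      ≤ ENNReal.ofReal (196 * η) := by
  classical
  set U : Set X := {a | ∃ g ∈ majorityClass H T, 1 - η < err D f g ∧ g a = f a} with hU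
  choose! g hg hgη hga using fun a (ha : a ∈ U) => ha
  have hcover : {v : Fin 14 → X | ∀ i ∈ Finset.univ, v i ∈ U} ⊆
      ⋃ ij ∈ (Finset.univ : Finset (Fin 14 × Fin 14)).filter fun ij => ij.1 ≠ ij.2,
        ⋃ u ∈ Finset.univ.filter (· ∈ U), {v | v ij.1 = u ∧ v ij.2 ∈ {a | g u a = f a}} := by
    intro v hv
    have hv' : ∀ i, v i ∈ U := fun i => hv i (Finset.mem_univ i)
    by_contra hcon
    refine not_fourteen_separated hγ hL hf hd hT v (fun i => g (v i)) (fun i => hg _ (hv' i))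
      (fun i => hga _ (hv' i)) fun i j hij he => hcon ?_
    refine Set.mem_iUnion₂.2 ⟨(i, j), Finset.mem_filter.2 ⟨Finset.mem_univ _, hij⟩, ?_⟩
    exact Set.mem_iUnion₂.2 ⟨v i, Finset.mem_filter.2 ⟨Finset.mem_univ _, hv' i⟩, rfl, he⟩
  have h1 := iid_toOuterMeasure_forall_mem D 14 Finset.univ U
  rw [Finset.card_univ, Fintype.card_fin] at h1
  rw [← h1]
  refine ((iid D 14).toOuterMeasure.mono hcover).trans ?_
  refine (MeasureTheory.measure_biUnion_finset_le (μ := (iid D 14).toOuterMeasure) _ _).trans ?_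
  have hpair : ∀ ij ∈ (Finset.univ : Finset (Fin 14 × Fin 14)).filter fun ij => ij.1 ≠ ij.2,
      (iid D 14).toOuterMeasure (⋃ u ∈ Finset.univ.filter (· ∈ U),
        {v | v ij.1 = u ∧ v ij.2 ∈ {a | g u a = f a}}) ≤ ENNReal.ofReal η := by
    intro ij hij
    refine (MeasureTheory.measure_biUnion_finset_le (μ := (iid D 14).toOuterMeasure) _ _).trans ?_
    calc ∑ u ∈ Finset.univ.filter (· ∈ U), (iid D 14).toOuterMeasure
          {v | v ij.1 = u ∧ v ij.2 ∈ {a | g u a = f a}}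
        ≤ ∑ u ∈ Finset.univ.filter (· ∈ U), D u * ENNReal.ofReal η := by
          refine Finset.sum_le_sum fun u hu => ?_
          rw [iid_toOuterMeasure_pair D 14 (Finset.mem_filter.1 hij).2]
          gcongr
          exact toOuterMeasure_le_of_lt_err D f _ (hgη u (Finset.mem_filter.1 hu).2)
      _ ≤ ∑ u, D u * ENNReal.ofReal η :=
          Finset.sum_le_sum_of_subset (Finset.filter_subset _ _)
      _ = ENNReal.ofReal η := by
          rw [← Finset.sum_mul, ← tsum_fintype (L := .unconditional _), D.tsum_coe, one_mul]
  calc _ ≤ ∑ ij ∈ (Finset.univ : Finset (Fin 14 × Fin 14)).filter fun ij => ij.1 ≠ ij.2,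
        ENNReal.ofReal η := Finset.sum_le_sum hpair
    _ ≤ ∑ ij : Fin 14 × Fin 14, ENNReal.ofReal η :=
        Finset.sum_le_sum_of_subset (Finset.filter_subset _ _)
    _ = ENNReal.ofReal (196 * η) := by
        rw [Finset.sum_const, Finset.card_univ, Fintype.card_prod, Fintype.card_fin, nsmul_eq_mul,
          ENNReal.ofReal_mul (by norm_num)]
        norm_num

end VCDimOne

/-! ### Sample complexity -/

section Sample

variable {X : Type*} [Fintype X] [DecidableEq X] {γ : ℝ} {C : Set (X → Bool)}
  {H : Finset (X → Bool)} {L : Learner X} {f : X → Bool}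

/-- The samples that some majority vote of `T` members of `H` fits up to an error of `ε / 2`,
although its generalization error exceeds `ε`. -/
def overfitting (D : PMF X) (f : X → Bool) (H : Finset (X → Bool)) (T m : ℕ) (ε : ℝ) :
    Set (Fin m → X) :=
  {x | ∃ g ∈ majorityClass H T, ε < err D f g ∧
    ((Finset.univ.filter fun i => g (x i) ≠ f (x i)).card : ℝ) < ε / 2 * m}

theorem overfitting_le_exp (D : PMF X) (f : X → Bool) (H : Finset (X → Bool)) (T m : ℕ) (ε : ℝ) :
    (iid D m).toOuterMeasure (overfitting D f H T m ε)
      ≤ ENNReal.ofReal ((2 * m + 1) ^ (vcDim H * T) * Real.exp (-(ε * m / 40))) := by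
  classical
  set G : Finset (X → Bool) := (majorityClass H T).image fun g a => decide (g a ≠ f a) with hG
  have hN : ∀ z : Fin m → X × X, (patterns G z).card ≤ (m * 2 + 1) ^ (vcDim H * T) := by
    intro z
    set u : Fin m × Bool → X := fun s => if s.2 then (z s.1).2 else (z s.1).1 with hu
    have h := card_image_majorityClass_le H T u
    rw [Fintype.card_prod, Fintype.card_fin, Fintype.card_bool] at h
    have hsub : patterns G z ⊆ ((majorityClass H T).image fun g => g ∘ u).image
        fun q i => (decide (q (i, false) ≠ f (z i).1), decide (q (i, true) ≠ f (z i).2)) := by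
      intro q hq
      obtain ⟨e, he, rfl⟩ := Finset.mem_image.1 hq
      obtain ⟨g, hg, rfl⟩ := Finset.mem_image.1 he
      exact Finset.mem_image.2 ⟨g ∘ u, Finset.mem_image_of_mem _ hg, by simp [hu]⟩
    exact (Finset.card_le_card hsub).trans (Finset.card_image_le.trans h)
  have h := relative_deviation D m G _ hN ε
  refine le_trans ((iid D m).toOuterMeasure.mono ?_) (h.trans (le_of_eq ?_))
  · rintro x ⟨g, hg, hgε, hgx⟩
    refine ⟨_, Finset.mem_image_of_mem _ hg, ?_, ?_⟩
    · simpa [err] using hgε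
    · have : ((Finset.univ.filter fun i => decide (g (x i) ≠ f (x i)) = true).card : ℝ)
          = ((Finset.univ.filter fun i => g (x i) ≠ f (x i)).card : ℝ) := by simp
      rw [this]
      linarith
  · push_cast
    rw [mul_comm (m : ℝ) 2]

/-- In VC-dimension zero a weak learner can only return the target itself. -/
theorem overfitting_eq_empty (hγ : 0 < γ) (hL : IsWeakLearner γ C H L) (hf : f ∈ C)
    (hd : vcDim H = 0) {T : ℕ} (hT : 0 < T) (D : PMF X) (m : ℕ) {ε : ℝ} (hε : 0 < ε) :
    overfitting D f H T m ε = ∅ := by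
  classical
  rw [Set.eq_empty_iff_forall_notMem]
  rintro x ⟨g, hg, hgε, _⟩
  have hHf : ∀ h ∈ H, h = f := by
    intro h hh
    funext a
    obtain ⟨h', hh', hcard⟩ := hL.exists_half_lt hγ hf (fun _ : Fin 1 => a)
    have heq : h = h' := by
      by_contra hne
      have := one_le_vcDim hh hh' hne
      omega
    have hpos : 0 < (Finset.univ.filter fun _ : Fin 1 => h' a = f a).card := by omega
    obtain ⟨_, hi⟩ := Finset.card_pos.1 hpos
    rw [heq]
    exact (Finset.mem_filter.1 hi).2
  obtain ⟨hs, rfl, hlen, hmem⟩ := mem_majorityClass.1 hg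
  have hmaj : ∀ a, majority hs a = f a := by
    intro a
    by_contra hne
    have h1 := two_mul_countP_le_of_majority_ne hs a (f a) hne
    have h2 : hs.countP (fun h => decide (h a = f a)) = hs.length :=
      List.countP_eq_length.2 fun h hh => by simp [hHf h (hmem h hh)]
    omega
  have : err D f (majority hs) = 0 := by simp [err, hmaj]
  linarith

/-- In VC-dimension one, with `ε` close to `1`, overfitting requires that some sample point is one
of the few points that a very inaccurate majority vote gets right. -/
theorem overfitting_le_of_vcDim_le_one (hγ : 0 < γ) (hL : IsWeakLearner γ C H L) (hf : f ∈ C)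
    (hd : vcDim H ≤ 1) {T : ℕ} (hT : 0 < T) (D : PMF X) (m : ℕ) [NeZero m] {ε η q : ℝ} (hε1 : ε < 1)
    (hε : 1 - η ≤ ε) (hq : 0 ≤ q) (hηq : 196 * η ≤ q ^ 14) :
    (iid D m).toOuterMeasure (overfitting D f H T m ε) ≤ ENNReal.ofReal (m * q) := by
  classical
  have hm : (0 : ℝ) < m := Nat.cast_pos.2 (Nat.pos_of_ne_zero (NeZero.ne m))
  set U : Set X := {a | ∃ g ∈ majorityClass H T, 1 - η < err D f g ∧ g a = f a} with hU
  have hUq : D.toOuterMeasure U ≤ ENNReal.ofReal q := by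
    have h := (pow_fourteen_le hγ hL hf hd hT D η).trans (ENNReal.ofReal_le_ofReal hηq)
    rw [ENNReal.ofReal_pow hq] at h
    exact (ENNReal.pow_le_pow_left_iff (by norm_num)).1 h
  have hcover : overfitting D f H T m ε ⊆
      ⋃ i ∈ (Finset.univ : Finset (Fin m)), {x | ∀ j ∈ ({i} : Finset (Fin m)), x j ∈ U} := by
    rintro x ⟨g, hg, hgε, hgx⟩
    have hex : ∃ i, g (x i) = f (x i) := by
      by_contra hcon
      push Not at hcon
      rw [Finset.filter_true_of_mem fun i _ => hcon i, Finset.card_univ, Fintype.card_fin] at hgx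
      nlinarith
    obtain ⟨i, hi⟩ := hex
    refine Set.mem_iUnion₂.2 ⟨i, Finset.mem_univ i, fun j hj => ?_⟩
    rw [Finset.mem_singleton.1 hj]
    exact ⟨g, hg, lt_of_le_of_lt hε hgε, hi⟩
  refine ((iid D m).toOuterMeasure.mono hcover).trans ?_
  refine (MeasureTheory.measure_biUnion_finset_le (μ := (iid D m).toOuterMeasure) _ _).trans ?_
  calc _ ≤ ∑ i : Fin m, ENNReal.ofReal q := Finset.sum_le_sum fun i _ => by
        rw [iid_toOuterMeasure_forall_mem, Finset.card_singleton, pow_one]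
        exact hUq
    _ = ENNReal.ofReal (m * q) := by
        rw [Finset.sum_const, Finset.card_univ, Fintype.card_fin, nsmul_eq_mul,
          ENNReal.ofReal_mul hm.le, ENNReal.ofReal_natCast]

end Sample

/-- If `R = ε² m / d` is large, then the growth function of the class of majority votes is
negligible compared with `exp (ε m / 40)`. Here `T` is the number of votes and `T ε ≤ a / 80`. -/
theorem growth_mul_exp_le {a ε δ d m : ℝ} {T : ℝ} (ha : 80 ≤ a) (hε : ε ∈ Set.Ioo (0 : ℝ) 1)
    (hδ : δ ∈ Set.Ioo (0 : ℝ) 1) (hd : 1 ≤ d) (hm : 1 ≤ m) (hT : 80 * (T * ε) ≤ a)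
    {c : ℝ} (hc : 160 ≤ c) (hca : 4 * a ≤ c) (hR : 64 * a ^ 2 ≤ ε ^ 2 * m / d)
    (hcm : c * (d * Real.log (d / (δ * ε)) + Real.log (1 / δ)) ≤ ε ^ 2 * m) :
    d * T * Real.log (2 * m + 1) - ε * m / 40 ≤ Real.log (δ / 2) := by
  obtain ⟨hε0, hε1⟩ := hε
  obtain ⟨hδ0, hδ1⟩ := hδ
  set R := ε ^ 2 * m / d with hRdef
  have hd0 : 0 < d := by linarith
  have hRd : ε ^ 2 * m = R * d := by rw [hRdef]; field_simp
  have hR0 : 0 < R := by positivity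
  have hlogδ : 0 ≤ Real.log (1 / δ) := Real.log_nonneg (by rw [le_div_iff₀ hδ0]; linarith)
  have hδε : δ * ε ≤ 1 := by nlinarith
  have hδε0 : 0 < δ * ε := mul_pos hδ0 hε0
  set Λ := Real.log (d / (δ * ε)) with hΛ
  have hΛ0 : 0 ≤ Λ := Real.log_nonneg (by rw [le_div_iff₀ hδε0]; linarith)
  have hcΛ : c * Λ ≤ R := by
    have h1 : d * (c * Λ) ≤ d * R := by nlinarith
    exact le_of_mul_le_mul_left h1 hd0
  -- the logarithm of the growth function grows like the square root of `R`
  have hlog : Real.log (2 * m + 1) ≤ Real.log (3 * R) + 2 * Λ := by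
    have e : Real.log (3 * R) + 2 * Λ = Real.log (3 * R * (d / (δ * ε)) ^ 2) := by
      rw [Real.log_mul (show 3 * R ≠ 0 by positivity) (by positivity), Real.log_pow]
      push_cast; ring
    rw [e]
    refine Real.log_le_log (by linarith) ?_
    have h1 : m = R * d / ε ^ 2 := by rw [← hRd]; field_simp
    have h2 : R * d / ε ^ 2 ≤ R * (d / (δ * ε)) ^ 2 := by
      rw [div_pow, mul_div_assoc]
      gcongr
      · nlinarith
      · nlinarith
    nlinarith
  have hsqrt : Real.log (3 * R) ≤ 4 * Real.sqrt R := by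
    have h1 : Real.log (Real.sqrt (3 * R)) ≤ Real.sqrt (3 * R) - 1 :=
      Real.log_le_sub_one_of_pos (Real.sqrt_pos.2 (by positivity))
    rw [Real.log_sqrt (by positivity)] at h1
    have h2 : Real.sqrt (3 * R) ≤ 2 * Real.sqrt R := by
      rw [Real.sqrt_le_left (by positivity), mul_pow, Real.sq_sqrt hR0.le]
      linarith
    linarith
  have hsq8 : 8 * a ≤ Real.sqrt R := Real.le_sqrt_of_sq_le (by nlinarith)
  have hRa : a * Real.log (2 * m + 1) ≤ R := by
    have hs := Real.sq_sqrt hR0.le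
    have h1 : a * Real.log (3 * R) ≤ R / 2 := by
      have h3 : a * Real.log (3 * R) ≤ a * (4 * Real.sqrt R) := by gcongr
      nlinarith [Real.sqrt_nonneg R]
    have h2 : a * (2 * Λ) ≤ R / 2 := by nlinarith
    have h3 : a * Real.log (2 * m + 1) ≤ a * (Real.log (3 * R) + 2 * Λ) := by gcongr
    linarith
  have hlogm : 0 ≤ Real.log (2 * m + 1) := Real.log_nonneg (by linarith)
  have hgrowth : 80 * (d * T * Real.log (2 * m + 1)) ≤ ε * m := by
    have h1 : 80 * (T * ε) * Real.log (2 * m + 1) ≤ R :=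
      le_trans (by gcongr) hRa
    have h2 : ε * (80 * (d * T * Real.log (2 * m + 1))) ≤ ε * (ε * m) := by
      calc ε * (80 * (d * T * Real.log (2 * m + 1)))
          = d * (80 * (T * ε) * Real.log (2 * m + 1)) := by ring
        _ ≤ d * R := by gcongr
        _ = ε * (ε * m) := by rw [mul_comm d, ← hRd]; ring
    exact le_of_mul_le_mul_left h2 hε0
  have hδm : 80 * Real.log (2 / δ) ≤ ε * m := by
    have h1 : Real.log (2 / δ) = Real.log 2 + Real.log (1 / δ) := by
      rw [← Real.log_mul (by norm_num) (by positivity)]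
      congr 1; ring
    have h2 : Real.log 2 ≤ 1 := by linarith [Real.log_two_lt_d9]
    have h3 : c * Real.log (1 / δ) ≤ R * d := by
      have : 0 ≤ c * (d * Λ) := by positivity
      nlinarith
    have h4 : 160 ≤ R * d := by nlinarith
    have h5 : R * d ≤ ε * m := by
      rw [← hRd]
      have : ε ^ 2 ≤ ε := by nlinarith
      gcongr
    have h6 : 160 * Real.log (1 / δ) ≤ c * Real.log (1 / δ) := by gcongr
    linarith
  have e : Real.log (δ / 2) = -Real.log (2 / δ) := by
    rw [← Real.log_inv, inv_div]
  rw [e]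
  linarith

/-- If `ε² m / d` is bounded by `R₀`, then the assumption on `m` forces `d = 1`, a bounded sample
size, and `ε` and `δ` close to `1`. -/
theorem small_sample {R₀ ε δ c : ℝ} {d m : ℕ} (hε : ε ∈ Set.Ioo (0 : ℝ) 1)
    (hδ : δ ∈ Set.Ioo (0 : ℝ) 1) (hd : 1 ≤ d) (hR₀ : 0 < R₀) (hc : 2 * R₀ ≤ c)
    (hR : ε ^ 2 * m / d < R₀)
    (hcm : c * (d * Real.log (d / (δ * ε)) + Real.log (1 / δ)) ≤ ε ^ 2 * m) :
    d = 1 ∧ (m : ℝ) ≤ 4 * R₀ ∧ 1 - R₀ / c ≤ ε ∧ 1 - R₀ / c ≤ δ := by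
  obtain ⟨hε0, hε1⟩ := hε
  obtain ⟨hδ0, hδ1⟩ := hδ
  have hd1 : (1 : ℝ) ≤ d := by exact_mod_cast hd
  have hd0 : (0 : ℝ) < d := by linarith
  have hc0 : 0 < c := by linarith
  have hδε0 : 0 < δ * ε := mul_pos hδ0 hε0
  have hlogδ : 0 ≤ Real.log (1 / δ) := Real.log_nonneg (by rw [le_div_iff₀ hδ0]; linarith)
  set Λ := Real.log (d / (δ * ε)) with hΛ
  have hΛc : Λ ≤ R₀ / c := by
    rw [div_lt_iff₀ hd0] at hR
    rw [le_div_iff₀ hc0]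
    have h1 : d * (Λ * c) ≤ d * R₀ := by nlinarith
    exact le_of_mul_le_mul_left h1 hd0
  have hhalf : R₀ / c ≤ 1 / 2 := by rw [div_le_iff₀ hc0]; linarith
  have hx0 : 0 < d / (δ * ε) := div_pos hd0 hδε0
  -- `1 - R₀ / c ≤ exp (-Λ) = δ ε / d`
  have hexp : 1 - R₀ / c ≤ δ * ε / d := by
    have h1 : -Λ + 1 ≤ Real.exp (-Λ) := Real.add_one_le_exp _
    rw [Real.exp_neg, hΛ, Real.exp_log hx0, inv_div] at h1
    linarith
  have hdlt : (d : ℝ) < 2 := by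
    by_contra hcon
    have : δ * ε / d < 1 / 2 := by
      rw [div_lt_iff₀ hd0]
      nlinarith [not_lt.1 hcon]
    linarith
  have hd' : d = 1 := by
    have : d < 2 := by exact_mod_cast hdlt
    omega
  rw [hd', Nat.cast_one, div_one] at hexp
  rw [hd', Nat.cast_one, div_one] at hR
  have hεhalf : 1 / 2 ≤ ε := by nlinarith
  have hm0 : (0 : ℝ) ≤ m := Nat.cast_nonneg m
  refine ⟨hd', ?_, by nlinarith, by nlinarith⟩
  have : (1 / 2 : ℝ) ^ 2 * m ≤ ε ^ 2 * m := by gcongr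
  linarith

theorem Params.T_mul_le (p : Params) : p.T * (2 * p.ε) ≤ 8 / p.γ ^ 2 + 2 := by
  have hε := p.hε.1
  have hε1 := p.hε.2
  have hγ := p.hγ.1
  have h1 : Real.log (1 / p.ε) ≤ 1 / p.ε := by
    have := Real.log_le_sub_one_of_pos (show 0 < 1 / p.ε by positivity)
    linarith
  have h0 : 0 ≤ Real.log (1 / p.ε) := Real.log_nonneg (by rw [le_div_iff₀ hε]; linarith)
  have h2 : (p.T : ℝ) ≤ 4 * Real.log (1 / p.ε) / p.γ ^ 2 + 1 := by
    unfold Params.T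
    push_cast
    gcongr
    exact Nat.floor_le (by positivity)
  calc p.T * (2 * p.ε) ≤ (4 * (1 / p.ε) / p.γ ^ 2 + 1) * (2 * p.ε) := by
        gcongr
        exact h2.trans (by gcongr)
    _ = 8 / p.γ ^ 2 + 2 * p.ε := by field_simp; ring
    _ ≤ _ := by linarith

end QBoost

end

theorem mainTheorem5 (γ : ℝ) (hγ : γ ∈ Set.Ioo (0 : ℝ) (1 / 2)) :
    ∃ c : ℝ, 0 < c ∧
      ∀ (X : Type*) [Fintype X] [DecidableEq X] (C : Set (X → Bool)) (H : Finset (X → Bool))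
        (L : QBoost.Learner X), QBoost.IsWeakLearner γ C H L →
      ∀ (ε δ : ℝ) (hε : ε ∈ Set.Ioo (0 : ℝ) 1) (hδ : δ ∈ Set.Ioo (0 : ℝ) 1) (m : ℕ) [NeZero m],
        c * (((QBoost.vcDim H : ℝ) * Real.log ((QBoost.vcDim H : ℝ) / (δ * ε)) + Real.log (1 / δ))
          / ε ^ 2) ≤ (m : ℝ) →
      ∀ f ∈ C, ∀ D : PMF X,
        ENNReal.ofReal (1 - δ) ≤
          ((QBoost.iid D m).bind fun x =>
            QBoost.quantumBoost
              { γ := γ, ε := ε / 2, δ := δ / 2, hγ := hγ, hε := QBoost.half_mem hε,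
                hδ := QBoost.half_mem hδ }
              L (fun i => QBoost.labelled f (x i))).toOuterMeasure
            {h | QBoost.err D f h ≤ ε} := by
  have hγ0 := hγ.1
  -- `a` bounds `80 T ε`; samples with `ε² m / d ≥ R₀` are treated by uniform convergence, and `c`
  -- is so large that otherwise a single union bound over the sample suffices
  obtain ⟨a, ha⟩ : ∃ a : ℝ, a = 80 * (8 / γ ^ 2 + 2) := ⟨_, rfl⟩
  obtain ⟨R₀, hR₀⟩ : ∃ R₀ : ℝ, R₀ = 64 * a ^ 2 := ⟨_, rfl⟩
  have ha80 : 80 ≤ a := by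
    have : 0 < 8 / γ ^ 2 := by positivity
    linarith
  have hR₀1 : 4 * a ≤ R₀ := by nlinarith
  have hR₀0 : 320 ≤ R₀ := by linarith
  obtain ⟨c, hc⟩ : ∃ c : ℝ, c = 196 * R₀ * (16 * R₀) ^ 14 := ⟨_, rfl⟩
  have hcR : 196 * R₀ ≤ c := by
    have : 1 ≤ (16 * R₀) ^ 14 := one_le_pow₀ (by linarith)
    rw [hc]
    nlinarith
  have hc0 : 0 < c := by linarith
  refine ⟨c, hc0, ?_⟩
  intro X _ _ C H L hL ε δ hε hδ m _ hm f hf D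
  set p : QBoost.Params :=
    { γ := γ, ε := ε / 2, δ := δ / 2, hγ := hγ, hε := QBoost.half_mem hε,
      hδ := QBoost.half_mem hδ } with hp
  have hm0 : (0 : ℝ) < m := Nat.cast_pos.2 (Nat.pos_of_ne_zero (NeZero.ne m))
  have hm1 : (1 : ℝ) ≤ m := by exact_mod_cast Nat.pos_of_ne_zero (NeZero.ne m)
  have hε0 := hε.1
  have hδ0 := hδ.1
  have hcm : c * ((QBoost.vcDim H : ℝ) * Real.log ((QBoost.vcDim H : ℝ) / (δ * ε))
      + Real.log (1 / δ)) ≤ ε ^ 2 * m := by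
    rw [← mul_div_assoc, div_le_iff₀ (by positivity)] at hm
    linarith
  have hsample : (QBoost.iid D m).toOuterMeasure (QBoost.overfitting D f H p.T m ε)
      ≤ ENNReal.ofReal (δ / 2) := by
    rcases Nat.eq_zero_or_pos (QBoost.vcDim H) with hd | hd
    · rw [QBoost.overfitting_eq_empty hγ0 hL hf hd p.T_pos D m hε0]
      simp
    by_cases hR : R₀ ≤ ε ^ 2 * m / QBoost.vcDim H
    · refine (QBoost.overfitting_le_exp D f H p.T m ε).trans (ENNReal.ofReal_le_ofReal ?_)
      have hTε : 80 * ((p.T : ℝ) * ε) ≤ a := by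
        have h1 := p.T_mul_le
        have h2 : 2 * p.ε = ε := by simp only [hp]; ring
        rw [h2] at h1
        rw [ha]
        exact mul_le_mul_of_nonneg_left h1 (by norm_num)
      have h := QBoost.growth_mul_exp_le ha80 hε hδ (by exact_mod_cast hd) hm1 hTε
        (by linarith) (by linarith) (hR₀ ▸ hR) hcm
      rw [← Real.exp_log (show 0 < 2 * (m : ℝ) + 1 by positivity), ← Real.exp_nat_mul,
        ← Real.exp_add, ← Real.exp_log (show 0 < δ / 2 by positivity)]
      refine Real.exp_le_exp.2 (le_trans (le_of_eq ?_) h)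
      push_cast
      ring
    · obtain ⟨hd1, hmR, hηε, hηδ⟩ := QBoost.small_sample hε hδ hd (by linarith) (by linarith)
        (not_le.1 hR) hcm
      have hq : 196 * (R₀ / c) ≤ (1 / (16 * R₀)) ^ 14 := by
        rw [hc, div_pow, one_pow]
        refine le_of_eq ?_
        have : R₀ ≠ 0 := by linarith
        field_simp
      refine (QBoost.overfitting_le_of_vcDim_le_one hγ0 hL hf hd1.le p.T_pos D m hε.2 hηε
        (by positivity) hq).trans (ENNReal.ofReal_le_ofReal ?_)
      have h1 : (m : ℝ) * (1 / (16 * R₀)) ≤ 1 / 4 := by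
        rw [mul_one_div, div_le_iff₀ (by linarith)]
        linarith
      have h2 : R₀ / c ≤ 1 / 2 := by
        rw [div_le_iff₀ hc0]
        linarith
      linarith
  have hfail : ((QBoost.iid D m).bind fun x =>
      QBoost.quantumBoost p L (fun i => QBoost.labelled f (x i))).toOuterMeasure
        {h | QBoost.err D f h ≤ ε}ᶜ ≤ ENNReal.ofReal (δ / 2) + ENNReal.ofReal (δ / 2) := by
    refine QBoost.toOuterMeasure_bind_le _ _ (QBoost.overfitting D f H p.T m ε)ᶜ _
      (by rwa [compl_compl]) fun x _ hx => ?_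
    refine le_trans (MeasureTheory.OuterMeasure.mono _ ?_)
      (QBoost.quantumBoost_failure p hL hf x)
    rintro g hg ⟨hs, hgs, hlen, hmem, hcard⟩
    refine hx ⟨g, QBoost.mem_majorityClass.2 ⟨hs, hgs, hlen, hmem⟩, not_le.1 hg, hcard⟩
  rw [← ENNReal.ofReal_add (by linarith) (by linarith), add_halves] at hfail
  have h1 := QBoost.one_le_toOuterMeasure_add_compl ((QBoost.iid D m).bind fun x =>
      QBoost.quantumBoost p L (fun i => QBoost.labelled f (x i))) {h | QBoost.err D f h ≤ ε}
  rw [ENNReal.ofReal_sub _ hδ0.le, ENNReal.ofReal_one, tsub_le_iff_right]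
  exact h1.trans (by gcongr)
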